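/- Let $\mathbb X$ be a finite-dimensional real inner product space with induced norm $\|\cdot\|$, let $f,g:\mathbb X\to(-\infty,\infty]$ be proper and $F:=f+g$. Assume that - $g$ is lower semicontinuous, convex, and continuous relative to ${\rm dom}\,g$; - $f$ is lower semicontinuous, and finite and twice continuously differentiable on an open set $\mathcal O\supset{\rm cl}({\rm dom}\,g)$; - $\inf_{\mathbb X}F>-\infty$. Let $\partial$ be the limiting (Mordukhovich) subdifferential and $S^*:=\{x : 0\in\nabla f(x)+\partial g(x)\}$ the set of stationary points. **Algorithm.** Let $\underline\mu>0$, $\beta\in(0,1)$, $0<\sigma<\frac12\min\{1,\underline\mu\}$, let $\{\varepsilon_k\}$ be a bounded sequence of positive reals with $\varepsilon_k\le\underline\mu/10$ for all large $k$, and let $x^0\in{\rm dom}\,g$. Let $\{(x^k,y^k)\}_{k\in\mathbb N}$ be an infinite sequence such that for every $k$ the following hold. There is a self-adjoint linear operator $\mathcal G_k$ on $\mathbb X$ with $\mathcal G_k\succeq\underline\mu\mathcal I$ such that, with $$\Theta_k(z):=f(x^k)+\langle\nabla f(x^k),z-x^k\rangle+\tfrac12\langle z-x^k,\mathcal G_k(z-x^k)\rangle+g(z)$$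 and $\overline x^k$ the minimizer of $\Theta_k$, $$\Theta_k(y^k)<\Theta_k(x^k),\qquad \Theta_k(y^k)-\Theta_k(\overline x^k)\le\varepsilon_k\|y^k-x^k\|^2 .$$ With $d^k:=y^k-x^k$, let $m_k$ be the smallest integer $m\ge0$ such that $F(x^k)-F(x^k+\beta^m d^k)\ge\sigma\beta^m\|d^k\|^2$, and put $\alpha_k:=\beta^{m_k}$. Then $x^{k+1}=y^k$ if $F(y^k)<F(x^k+\alpha_kd^k)$, and $x^{k+1}=x^k+\alpha_kd^k$ otherwise. **KL functions.** A proper function $h:\mathbb X\to(-\infty,\infty]$ is a KL function of exponent $\theta\in[0,1)$ if for every $\hat x$ with $\partial h(\hat x)\ne\emptyset$ there are $\delta>0$, $\varpi\in(0,\infty]$ and $c>0$ such that, with $\varphi(t)=ct^{1-\theta}$, one has $\varphi'(h(x)-h(\hat x))\,{\rm dist}(0,\partial h(x))\ge1$ for all $x$ with $\|x-\hat x\|\le\delta$ and $h(\hat x)<h(x)<h(\hat x)+\varpi$ (with ${\rm dist}(0,\emptyset)=\infty$). **Corollary.** Suppose that $\{x^k\}$ is bounded, that $\overline\mu>0$ satisfies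 $\|\mathcal G_k\|\le\overline\mu$ (operator norm) for all $k$, and that for some $\varepsilon>0$ the set $U:=\bigcup_{x\in S^*}\mathbb B(x,\varepsilon)$ (a union of closed balls) is contained in $\mathcal O$ and $\sup_{x\in U}{\rm lip}\,\nabla f(x)<\overline\mu$, where ${\rm lip}\,\nabla f(x):=\limsup_{u,v\to x,\ u\ne v}\|\nabla f(u)-\nabla f(v)\|/\|u-v\|$. If $F$ is a KL function of exponent $\theta\in[\frac12,1)$, then $\{x^k\}$ converges to a point $\overline x\in S^*$, and there are $\varrho\in(0,1)$ and $c_1>0$ such that for all sufficiently large $k$ $$\|x^k-\overline x\|\le\begin{cases}c_1\varrho^{k}&\text{if }\theta=\frac12,\\ c_1k^{\frac{1-\theta}{1-2\theta}}&\text{if }\theta\in(\frac12,1).\end{cases}$$ In particular, the convergence is R-linear when $\theta=\frac12$. -/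

import Mathlib

open Filter Topology
open scoped ENNReal

noncomputable section

namespace VMiPG

variable {X : Type*} [NormedAddCommGroup X] [InnerProductSpace ℝ X]

/-- The effective domain of an extended real-valued function. -/
def dom (h : X → EReal) : Set X := {x | h x < ⊤}

/-- A proper function takes values in `(-∞, ∞]` and is not identically `∞`. -/
def IsProper (h : X → EReal) : Prop := (∀ x, h x ≠ ⊥) ∧ (dom h).Nonempty

/-- Convexity of a function with values in `(-∞, ∞]`. -/
def IsConvex (h : X → EReal) : Prop :=
  ∀ x y : X, ∀ a b : ℝ, 0 < a → 0 < b → a + b = 1 →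
    h (a • x + b • y) ≤ (a : EReal) * h x + (b : EReal) * h y

/-- The regular (Fréchet) subdifferential: `h x` is finite and
`h z ≥ h x + ⟪v, z - x⟫ - o(‖z - x‖)` as `z → x`. -/
def regularSubdiff (h : X → EReal) (x : X) : Set X :=
  {v | h x ≠ ⊤ ∧ h x ≠ ⊥ ∧ ∀ η : ℝ, 0 < η → ∀ᶠ z in 𝓝 x,
    h x + ((inner ℝ v (z - x) - η * ‖z - x‖ : ℝ) : EReal) ≤ h z}

/-- The limiting (Mordukhovich) subdifferential `∂h(x)`. It is the subdifferential of convex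
analysis when `h` is convex. -/
def subdiff (h : X → EReal) (x : X) : Set X :=
  {v | h x ≠ ⊤ ∧ h x ≠ ⊥ ∧ ∃ (u w : ℕ → X),
    Tendsto u atTop (𝓝 x) ∧ Tendsto (fun n => h (u n)) atTop (𝓝 (h x)) ∧
    (∀ n, w n ∈ regularSubdiff h (u n)) ∧ Tendsto w atTop (𝓝 v)}

/-- The Kurdyka-Łojasiewicz property of exponent `θ` at `xbar`: with `φ(t) = c t ^ (1 - θ)`,
`φ'(h(x) - h(xbar)) * dist(0, ∂h(x)) ≥ 1` for all `x` in a closed ball around `xbar` such that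
`h(xbar) < h(x) < h(xbar) + ϖ`. The distance to the empty set is `∞`. -/
def HasKLExponentAt (h : X → EReal) (θ : ℝ) (xbar : X) : Prop :=
  ∃ δ : ℝ, 0 < δ ∧ ∃ ϖ : EReal, 0 < ϖ ∧ ∃ c : ℝ, 0 < c ∧
    ∀ x ∈ Metric.closedBall xbar δ, h xbar < h x → h x < h xbar + ϖ →
      1 ≤ ENNReal.ofReal (deriv (fun t : ℝ => c * t ^ (1 - θ)) ((h x).toReal - (h xbar).toReal)) *
        Metric.infEDist (0 : X) (subdiff h x)

/-- `h` is a KL function of exponent `θ`: it is proper and has the KL property of exponent `θ` at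
every point of `dom ∂h`. -/
def IsKLFunctionOfExponent (h : X → EReal) (θ : ℝ) : Prop :=
  IsProper h ∧ ∀ xbar : X, (subdiff h xbar).Nonempty → HasKLExponentAt h θ xbar

/-- The Lipschitz modulus of `T` at `x`: the upper limit of `‖T p - T q‖ / ‖p - q‖` as
`p, q → x` with `p ≠ q`. -/
def lipModulus (T : X → X) (x : X) : ℝ≥0∞ :=
  limsup (fun p : X × X => edist (T p.1) (T p.2) / edist p.1 p.2)
    (𝓝 (x, x) ⊓ 𝓟 {p : X × X | p.1 ≠ p.2})

/-- The objective `F = f + g`. -/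
def objective (f g : X → EReal) (x : X) : EReal := f x + g x

variable [FiniteDimensional ℝ X]

/-- The gradient of an extended real-valued function (used at points near which it is finite and
differentiable). -/
def grad (f : X → EReal) (x : X) : X := gradient (fun z => (f z).toReal) x

/-- The basic assumption on the problem `min f + g`. -/
structure BasicAssumption (f g : X → EReal) (O : Set X) : Prop where
  proper_f : IsProper f
  proper_g : IsProper g
  lsc_g : LowerSemicontinuous g
  convex_g : IsConvex g
  continuousOn_g : ContinuousOn g (dom g)
  lsc_f : LowerSemicontinuous f
  isOpen_O : IsOpen O
  closure_dom_subset : closure (dom g) ⊆ O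
  finite_f : O ⊆ dom f
  contDiffOn_f : ContDiffOn ℝ 2 (fun x => (f x).toReal) O
  bddBelow_F : ∃ c : ℝ, ∀ x, (c : EReal) ≤ objective f g x

/-- The set `S*` of stationary points, `0 ∈ ∇f(x) + ∂g(x)`. -/
def stationarySet (f g : X → EReal) : Set X := {x | -grad f x ∈ subdiff g x}

/-- The strongly convex model
`Θ(z) = f(x) + ⟪∇f(x), z - x⟫ + ½ ⟪z - x, G (z - x)⟫ + g(z)` at the current iterate `x`. -/
def model (f g : X → EReal) (G : X →L[ℝ] X) (x z : X) : EReal :=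
  f x + ((inner ℝ (grad f x) (z - x) + 1 / 2 * inner ℝ (z - x) (G (z - x)) : ℝ) : EReal) + g z

/-- Armijo test: `F(x) - F(x + β^m d) ≥ σ β^m ‖d‖²`. -/
def ArmijoTest (f g : X → EReal) (β σ : ℝ) (x d : X) (m : ℕ) : Prop :=
  objective f g (x + β ^ m • d) + ((σ * β ^ m * ‖d‖ ^ 2 : ℝ) : EReal) ≤ objective f g x

/-- `(x, y)` is an (infinite) sequence generated by the line-search based variable metric inexact
proximal gradient method with parameters `μ` (lower bound for the metrics), `β`, `σ`, inexactness
parameters `ε`, metrics `G` and line-search exponents `m`. -/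
structure IsVMiPGSequence (f g : X → EReal) (μ β σ : ℝ) (ε : ℕ → ℝ) (G : ℕ → X →L[ℝ] X)
    (x y : ℕ → X) (m : ℕ → ℕ) : Prop where
  μ_pos : 0 < μ
  β_pos : 0 < β
  β_lt_one : β < 1
  σ_pos : 0 < σ
  σ_lt : σ < 1 / 2 * min 1 μ
  ε_pos : ∀ k, 0 < ε k
  ε_bdd : BddAbove (Set.range ε)
  ε_eventually_le : ∃ K : ℕ, ∀ k ≥ K, ε k ≤ μ / 10
  x_zero_mem : x 0 ∈ dom g
  G_selfAdjoint : ∀ k, IsSelfAdjoint (G k)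
  G_ge : ∀ k v, μ * ‖v‖ ^ 2 ≤ inner ℝ v (G k v)
  model_decrease : ∀ k, model f g (G k) (x k) (y k) < model f g (G k) (x k) (x k)
  inexact : ∀ k, ∃ xmin : X, (∀ z, model f g (G k) (x k) xmin ≤ model f g (G k) (x k) z) ∧
    model f g (G k) (x k) (y k) ≤
      model f g (G k) (x k) xmin + ((ε k * ‖y k - x k‖ ^ 2 : ℝ) : EReal)
  line_search : ∀ k, IsLeast {j : ℕ | ArmijoTest f g β σ (x k) (y k - x k) j} (m k)
  next_full : ∀ k,
    objective f g (y k) < objective f g (x k + β ^ m k • (y k - x k)) → x (k + 1) = y k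
  next_armijo : ∀ k,
    ¬ objective f g (y k) < objective f g (x k + β ^ m k • (y k - x k)) →
      x (k + 1) = x k + β ^ m k • (y k - x k)

end VMiPG

end

namespace VMiPG

/-! Write `d k = y k - x k` and let `F*` be the limit of the decreasing values `F (x k)`. The line
search gives `A ‖d k‖² ≤ F (x k) - F (x (k+1))` with a fixed `A > 0`, because step sizes stay
bounded below (`step_size_ge`) on a compact convex set where `∇f` is Lipschitz.

The Kurdyka-Łojasiewicz inequality is not applied at `x k` or `y k`, where no small subgradient is
at hand, but at the exact minimizer `w k` of the model. Its optimality condition exhibits `∇f (w k)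
- ∇f (x k) - G k (w k - x k)` as a subgradient of `F`, of norm `O(‖d k‖)`, since strong convexity
and the inexactness test place `w k` within `2 ‖d k‖` of `x k`. The update never does worse than `y
k`, and `y k` nearly minimizes the model, so `F (x (k+1)) ≤ F (w k) + O(‖d k‖²)`. As `θ ≥ 1/2`, the
quadratic error is harmless after raising to the power `θ`, and `(F (x (k+1)) - F*) ^ θ ≤ C ‖d k‖`.

Cluster points are stationary with value `F*` (`mem_stationarySet_of_tendsto`), and compactness
yields one KL constant for all large `k` (`exists_eventually_rpow_le`). The two inequalities then
imply finite length and the rates by a purely real-variable argument, `rates_of_recursion`. -/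

/-! ### Scalar recursions and convergence rates -/

/-- The tangent inequality for the concave function `t ↦ t ^ q`. -/
lemma rpow_le_tangent {a b q : ℝ} (hb : 0 < b) (hab : b ≤ a) (hq : 0 ≤ q) (hq1 : q ≤ 1) :
    b ^ q ≤ a ^ q - q * a ^ (q - 1) * (a - b) := by
  have ha : 0 < a := hb.trans_le hab
  have h := rpow_one_add_le_one_add_mul_self (s := (b - a) / a) (p := q)
    (by rw [le_div_iff₀ ha]; linarith) hq hq1
  have h1 : 1 + (b - a) / a = b / a := by field_simp; ring
  rw [h1, Real.div_rpow hb.le ha.le, div_le_iff₀ (Real.rpow_pos_of_pos ha q)] at h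
  rw [Real.rpow_sub_one ha.ne']
  calc b ^ q ≤ _ := h
    _ = _ := by field_simp; ring

/-- One step of the sublinear rate: `a ^ (-p)` grows by a definite amount. The tangent at `a` bounds
`a ^ p - b ^ p` below by `p * a ^ (p - 1) * (a - b)`, and the hypothesis gives `a * b ^ p = (a - b)
* b ^ p + b ^ (1 + p) ≤ (a - b) * (M + b ^ p)`. -/
lemma inv_rpow_step {a b M p : ℝ} (hb : 0 < b) (hab : b ≤ a) (hp : 0 < p) (hp1 : p ≤ 1)
    (hM : 0 < M) (h : b ^ (1 + p) ≤ M * (a - b)) :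
    (a ^ p)⁻¹ + p / (M + b ^ p) ≤ (b ^ p)⁻¹ := by
  have ha : 0 < a := hb.trans_le hab
  have hbp : 0 < b ^ p := Real.rpow_pos_of_pos hb p
  have hap : 0 < a ^ p := Real.rpow_pos_of_pos ha p
  have ht := rpow_le_tangent hb hab hp.le hp1
  rw [Real.rpow_sub_one ha.ne'] at ht
  rw [Real.rpow_add hb, Real.rpow_one] at h
  have h1 : p / (M + b ^ p) ≤ p * (a - b) / (a * b ^ p) := by
    rw [div_le_div_iff₀ (by positivity) (by positivity)]
    have : a * b ^ p ≤ (a - b) * (M + b ^ p) := by linarith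
    calc p * (a * b ^ p) ≤ p * ((a - b) * (M + b ^ p)) := by gcongr
      _ = _ := by ring
  have h2 : p * (a - b) / (a * b ^ p) ≤ (b ^ p)⁻¹ - (a ^ p)⁻¹ := by
    have : (b ^ p)⁻¹ - (a ^ p)⁻¹ = (a ^ p - b ^ p) / (a ^ p * b ^ p) := by field_simp
    rw [this, show p * (a - b) / (a * b ^ p) = (p * (a ^ p / a) * (a - b)) / (a ^ p * b ^ p) by
      field_simp]
    gcongr
    linarith
  linarith

/-- Concavity of `t ↦ t ^ (1 - θ)` turns the two bounds into `t ^ 2 ≤ s * e`, with `e` a multiple of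
the drop in the desingularized values; the arithmetic-geometric mean inequality splits the product.
The factor `1 / 2` on the previous step `s` is what makes the lengths summable. -/
lemma step_length_le {a b θ A C s t : ℝ} (hb : 0 < b) (hab : b ≤ a) (hθ : 0 ≤ θ) (hθ1 : θ < 1)
    (hA : 0 < A) (hC : 0 ≤ C) (hs : 0 ≤ s) (h1 : A * t ^ 2 ≤ a - b) (h2 : a ^ θ ≤ C * s) :
    t ≤ s / 2 + C / (2 * A * (1 - θ)) * (a ^ (1 - θ) - b ^ (1 - θ)) := by
  have ha : 0 < a := hb.trans_le hab
  have hθ2 : 0 < 1 - θ := by linarith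
  have haθ : 0 < a ^ θ := Real.rpow_pos_of_pos ha θ
  have ht := rpow_le_tangent (q := 1 - θ) hb hab hθ2.le (by linarith)
  rw [show (1 - θ - 1 : ℝ) = -θ by ring, Real.rpow_neg ha.le] at ht
  set φ := a ^ (1 - θ) - b ^ (1 - θ) with hφ
  have h3 : (1 - θ) * (a - b) ≤ a ^ θ * φ := by
    have : (1 - θ) * (a ^ θ)⁻¹ * (a - b) ≤ φ := by linarith
    calc (1 - θ) * (a - b) = a ^ θ * ((1 - θ) * (a ^ θ)⁻¹ * (a - b)) := by field_simp
      _ ≤ _ := by gcongr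
  have hφ0 : 0 ≤ φ := by
    have := Real.rpow_le_rpow hb.le hab hθ2.le
    linarith
  set e := C / (A * (1 - θ)) * φ with he
  have he0 : 0 ≤ e := by positivity
  have h4 : t ^ 2 ≤ s * e := by
    have : A * (1 - θ) * t ^ 2 ≤ C * s * φ := by
      calc A * (1 - θ) * t ^ 2 = (1 - θ) * (A * t ^ 2) := by ring
        _ ≤ (1 - θ) * (a - b) := by gcongr
        _ ≤ a ^ θ * φ := h3
        _ ≤ C * s * φ := by gcongr
    calc t ^ 2 = (A * (1 - θ) * t ^ 2) / (A * (1 - θ)) := by field_simp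
      _ ≤ (C * s * φ) / (A * (1 - θ)) := by gcongr
      _ = s * e := by rw [he]; ring
  have h5 : t ≤ (s + e) / 2 := by
    apply abs_le_of_sq_le_sq' _ (by positivity) |>.2
    nlinarith [sq_nonneg (s - e)]
  calc t ≤ (s + e) / 2 := h5
    _ = _ := by rw [he]; field_simp

/-- A sequence whose steps are dominated by the decrease of a nonnegative null sequence converges
to any of its cluster points, at the rate of the null sequence. -/
lemma norm_sub_le_of_step_le {E : Type*} [NormedAddCommGroup E] {x : ℕ → E} {Ψ : ℕ → ℝ} {l : E}
    (hΨ : ∀ k, 0 ≤ Ψ k) (h : ∀ k, ‖x (k + 1) - x k‖ ≤ Ψ k - Ψ (k + 1))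
    (hl : MapClusterPt l atTop x) (k : ℕ) : ‖x k - l‖ ≤ Ψ k := by
  have h1 : ∀ n, ‖x (k + n) - x k‖ ≤ Ψ k - Ψ (k + n) := by
    intro n
    induction n with
    | zero => simp
    | succ n ih =>
      calc ‖x (k + (n + 1)) - x k‖ = ‖(x (k + n + 1) - x (k + n)) + (x (k + n) - x k)‖ := by
            rw [sub_add_sub_cancel]; rfl
        _ ≤ ‖x (k + n + 1) - x (k + n)‖ + ‖x (k + n) - x k‖ := norm_add_le _ _
        _ ≤ (Ψ (k + n) - Ψ (k + n + 1)) + (Ψ k - Ψ (k + n)) := add_le_add (h _) ih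
        _ = _ := by rw [← add_assoc]; ring
  have h2 : ∀ᶠ n in atTop, x n ∈ Metric.closedBall (x k) (Ψ k) := by
    filter_upwards [eventually_ge_atTop k] with n hn
    obtain ⟨j, rfl⟩ := Nat.exists_eq_add_of_le hn
    rw [mem_closedBall_iff_norm]
    linarith [h1 j, hΨ (k + j)]
  have h3 : l ∈ Metric.closedBall (x k) (Ψ k) :=
    Metric.isClosed_closedBall.mem_of_mapClusterPt hl h2
  rw [mem_closedBall_iff_norm'] at h3
  exact h3

/-- Summing `inv_rpow_step`: since `Δ` decreases, every increment of `Δ ^ (-p)` is at least the one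
computed with `Δ 0` in the denominator. -/
lemma rpow_le_of_forall_step {Δ : ℕ → ℝ} {M p : ℝ} (hΔ : ∀ k, 0 < Δ k) (hp : 0 < p) (hp1 : p ≤ 1)
    (hM : 0 < M) (hanti : ∀ k, Δ (k + 1) ≤ Δ k)
    (h : ∀ k, Δ (k + 1) ^ (1 + p) ≤ M * (Δ k - Δ (k + 1))) :
    ∃ c : ℝ, 0 < c ∧ ∀ k : ℕ, c * k ≤ (Δ k ^ p)⁻¹ := by
  have hA : Antitone Δ := antitone_nat_of_succ_le hanti
  have h0 : 0 < Δ 0 ^ p := Real.rpow_pos_of_pos (hΔ 0) p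
  refine ⟨p / (M + Δ 0 ^ p), by positivity, fun k => ?_⟩
  induction k with
  | zero => simpa using (Real.rpow_pos_of_pos (hΔ 0) p).le
  | succ k ih =>
    have h1 := inv_rpow_step (hΔ (k + 1)) (hanti k) hp hp1 hM (h k)
    have h2 : p / (M + Δ 0 ^ p) ≤ p / (M + Δ (k + 1) ^ p) := by
      have := Real.rpow_le_rpow (hΔ (k + 1)).le (hA (Nat.zero_le (k + 1))) hp.le
      have := Real.rpow_pos_of_pos (hΔ (k + 1)) p
      gcongr
    push_cast
    linarith

/-- Convergence rates for a sequence of iterates whose function value gaps `Δ` satisfy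
`Δ (k + 1) ^ θ ≤ C * s k` and `A * s k ^ 2 ≤ Δ k - Δ (k + 1)`, where `s k` bounds the step. -/
theorem rates_of_recursion {E : Type*} [NormedAddCommGroup E] {x : ℕ → E} {s Δ : ℕ → ℝ} {l : E}
    {θ A C : ℝ} (hθ : 1 / 2 ≤ θ) (hθ1 : θ < 1) (hA : 0 < A) (hC : 0 < C) (hs : ∀ k, 0 ≤ s k)
    (hΔ : ∀ k, 0 < Δ k) (hΔ0 : Tendsto Δ atTop (𝓝 0)) (hs0 : Tendsto s atTop (𝓝 0))
    (hx : ∀ k, ‖x (k + 1) - x k‖ ≤ s k) (h1 : ∀ k, A * s k ^ 2 ≤ Δ k - Δ (k + 1))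
    (h2 : ∀ k, Δ (k + 1) ^ θ ≤ C * s k) (hl : MapClusterPt l atTop x) :
    Tendsto x atTop (𝓝 l) ∧ ∃ ϱ c₁ : ℝ, 0 < ϱ ∧ ϱ < 1 ∧ 0 < c₁ ∧
      (θ = 1 / 2 → ∀ᶠ k : ℕ in atTop, ‖x k - l‖ ≤ c₁ * ϱ ^ k) ∧
      (1 / 2 < θ → ∀ᶠ k : ℕ in atTop, ‖x k - l‖ ≤ c₁ * (k : ℝ) ^ ((1 - θ) / (1 - 2 * θ))) := by
  have hθ2 : 0 < 1 - θ := by linarith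
  have hanti : ∀ k, Δ (k + 1) ≤ Δ k := fun k => by
    have := h1 k; have : 0 ≤ A * s k ^ 2 := by positivity
    linarith
  set B := C / (2 * A * (1 - θ)) with hB
  have hB0 : 0 < B := by positivity
  have hφ : ∀ k, 0 < Δ k ^ (1 - θ) := fun k => Real.rpow_pos_of_pos (hΔ k) _
  -- Twice the bound `s (k+1) ≤ s k / 2 + B * (drop)`, minus `s (k+1)`, telescopes in this
  -- potential. The gap carries index `k + 1` because `s k` controls `Δ (k + 1)`.
  set Ψ : ℕ → ℝ := fun k => s k + 2 * B * Δ (k + 1) ^ (1 - θ) with hΨ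
  have hstep : ∀ k, ‖x (k + 1 + 1) - x (k + 1)‖ ≤ Ψ k - Ψ (k + 1) := fun k => by
    have h3 := step_length_le (hΔ (k + 1 + 1)) (hanti (k + 1)) (by linarith) hθ1 hA hC.le (hs k)
      (h1 (k + 1)) (h2 k)
    have := hx (k + 1)
    simp only [hΨ]
    linarith
  have hl' : MapClusterPt l atTop (fun k => x (k + 1)) := by
    have : map (fun k => x (k + 1)) atTop = map x atTop := by
      rw [show (fun k => x (k + 1)) = x ∘ (fun k => k + 1) from rfl, ← Filter.map_map,
        map_add_atTop_eq_nat]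
    unfold MapClusterPt
    rw [this]; exact hl
  have hmain : ∀ k, ‖x (k + 1) - l‖ ≤ Ψ k :=
    norm_sub_le_of_step_le (fun k => add_nonneg (hs k) (mul_pos (by positivity) (hφ _)).le)
      hstep hl'
  have hΨ0 : Tendsto Ψ atTop (𝓝 0) := by
    have h3 : Tendsto (fun k => Δ (k + 1) ^ (1 - θ)) atTop (𝓝 0) := by
      have := ((tendsto_add_atTop_iff_nat 1).2 hΔ0).rpow_const (p := 1 - θ) (Or.inr hθ2.le)
      rwa [Real.zero_rpow hθ2.ne'] at this
    simpa using hs0.add (h3.const_mul (2 * B))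
  have hlim : Tendsto x atTop (𝓝 l) := by
    rw [← tendsto_add_atTop_iff_nat 1, tendsto_iff_norm_sub_tendsto_zero]
    exact squeeze_zero (fun _ => norm_nonneg _) hmain hΨ0
  refine ⟨hlim, ?_⟩
  -- the tail is bounded by a power of the gap
  obtain ⟨K, hK1⟩ : ∃ K, ∀ k ≥ K, Δ k ≤ 1 :=
    eventually_atTop.1 (hΔ0.eventually (eventually_le_nhds (by norm_num)))
  set N := (Real.sqrt A)⁻¹ + 2 * B with hN
  have hsA : 0 < Real.sqrt A := Real.sqrt_pos.2 hA
  have hN0 : 0 < N := by positivity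
  have htail : ∀ k ≥ K, ‖x (k + 1) - l‖ ≤ N * Δ k ^ (1 - θ) := fun k hk => by
    have h3 : s k ≤ (Real.sqrt A)⁻¹ * Δ k ^ (1 - θ) := by
      have h4 : Real.sqrt A * s k ≤ Real.sqrt (Δ k) := by
        apply Real.le_sqrt_of_sq_le
        rw [mul_pow, Real.sq_sqrt hA.le]
        linarith [h1 k, hΔ (k + 1)]
      have h5 : Real.sqrt (Δ k) ≤ Δ k ^ (1 - θ) := by
        rw [Real.sqrt_eq_rpow]
        exact Real.rpow_le_rpow_of_exponent_ge (hΔ k) (hK1 k hk) (by linarith)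
      rw [inv_mul_eq_div, le_div_iff₀ hsA]
      linarith
    have h4 := Real.rpow_le_rpow (hΔ (k + 1)).le (hanti k) hθ2.le
    calc ‖x (k + 1) - l‖ ≤ s k + 2 * B * Δ (k + 1) ^ (1 - θ) := hmain k
      _ ≤ (Real.sqrt A)⁻¹ * Δ k ^ (1 - θ) + 2 * B * Δ k ^ (1 - θ) := by gcongr
      _ = _ := by rw [hN]; ring
  set M := C ^ 2 / A with hM
  have hM0 : 0 < M := by positivity
  -- Squaring the KL bound and inserting the decrease eliminates `s k`; the exponent `2 * θ` is
  -- split as `1 + p` to fit the scalar lemma.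
  have hrec : ∀ k, Δ (k + 1) ^ (1 + (2 * θ - 1)) ≤ M * (Δ k - Δ (k + 1)) := fun k => by
    have h3 : Δ (k + 1) ^ (1 + (2 * θ - 1)) = (Δ (k + 1) ^ θ) ^ 2 := by
      rw [← Real.rpow_mul_natCast (hΔ _).le]; congr 1; push_cast; ring
    rw [h3]
    have h4 : 0 ≤ Δ (k + 1) ^ θ := (Real.rpow_pos_of_pos (hΔ _) _).le
    calc (Δ (k + 1) ^ θ) ^ 2 ≤ (C * s k) ^ 2 := by gcongr; exact h2 k
      _ = M * (A * s k ^ 2) := by rw [hM]; field_simp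
      _ ≤ _ := by gcongr; exact h1 k
  rcases eq_or_lt_of_le hθ with hθe | hθl
  · -- linear rate
    subst hθe
    set q := M / (1 + M) with hq
    have hq0 : 0 < q := by positivity
    have hq1 : q < 1 := by rw [hq, div_lt_one (by positivity)]; linarith
    have hlin : ∀ k, Δ k ≤ Δ 0 * q ^ k := fun k => by
      induction k with
      | zero => simp
      | succ k ih =>
        have h3 := hrec k
        norm_num at h3
        have : Δ (k + 1) ≤ q * Δ k := by
          rw [hq, div_mul_eq_mul_div, le_div_iff₀ (by positivity)]
          linarith
        calc Δ (k + 1) ≤ q * Δ k := this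
          _ ≤ q * (Δ 0 * q ^ k) := by gcongr
          _ = _ := by ring
    -- The gaps contract by `q`, while the distance is of the order of their square root.
    set ϱ := Real.sqrt q with hϱ
    have hϱ0 : 0 < ϱ := Real.sqrt_pos.2 hq0
    refine ⟨ϱ, N * Real.sqrt (Δ 0) / ϱ, hϱ0, ?_, ?_, fun _ => ?_, fun h => absurd h (lt_irrefl _)⟩
    · rw [hϱ, Real.sqrt_lt' one_pos]; simpa using hq1
    · have := Real.sqrt_pos.2 (hΔ 0); positivity
    · filter_upwards [eventually_ge_atTop (K + 1)] with k hk
      obtain ⟨j, rfl⟩ : ∃ j, k = j + 1 := ⟨k - 1, by omega⟩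
      have h3 : Δ j ^ (1 - 1 / 2 : ℝ) ≤ Real.sqrt (Δ 0) * ϱ ^ j := by
        rw [show (1 - 1 / 2 : ℝ) = 1 / 2 by norm_num, ← Real.sqrt_eq_rpow, Real.sqrt_le_left
          (by positivity), mul_pow, Real.sq_sqrt (hΔ 0).le, ← pow_mul, mul_comm j 2, pow_mul,
          Real.sq_sqrt hq0.le]
        exact hlin j
      calc ‖x (j + 1) - l‖ ≤ N * Δ j ^ (1 - 1 / 2 : ℝ) := htail j (by omega)
        _ ≤ N * (Real.sqrt (Δ 0) * ϱ ^ j) := by gcongr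
        _ = _ := by rw [pow_succ]; field_simp
  · -- sublinear rate
    set p := 2 * θ - 1 with hp
    have hp0 : 0 < p := by linarith
    obtain ⟨c, hc, hck⟩ := rpow_le_of_forall_step hΔ hp0 (by linarith) hM0 hanti hrec
    set e := (1 - θ) / (1 - 2 * θ) with he
    have he' : e = -((1 - θ) / p) := by
      rw [he, hp, ← div_neg]; congr 1; ring
    -- The ratio `1 / 2` is a dummy value here; `c / 2` pays for the index shift through `j + 1 ≤ 2
    -- * j`.
    refine ⟨1 / 2, N * (c / 2) ^ e, by norm_num, by norm_num,
      mul_pos hN0 (Real.rpow_pos_of_pos (by positivity) _), fun h => absurd h hθl.ne',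
      fun _ => ?_⟩
    filter_upwards [eventually_ge_atTop (K + 2)] with k hk
    obtain ⟨j, rfl⟩ : ∃ j, k = j + 1 := ⟨k - 1, by omega⟩
    have hj : (1 : ℝ) ≤ j := by exact_mod_cast (by omega : 1 ≤ j)
    have h3 : c / 2 * ((j + 1 : ℕ) : ℝ) ≤ (Δ j ^ p)⁻¹ := by
      refine le_trans ?_ (hck j)
      push_cast
      nlinarith
    have hΔp : 0 < Δ j ^ p := Real.rpow_pos_of_pos (hΔ j) p
    have h4 : Δ j ^ (1 - θ) = ((Δ j ^ p)⁻¹) ^ e := by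
      rw [he', Real.rpow_neg (inv_pos.2 hΔp).le, Real.inv_rpow hΔp.le, inv_inv,
        ← Real.rpow_mul (hΔ j).le]
      congr 1; field_simp
    have h5 : ((Δ j ^ p)⁻¹) ^ e ≤ (c / 2 * ((j + 1 : ℕ) : ℝ)) ^ e :=
      Real.rpow_le_rpow_of_nonpos (by positivity) h3 (by rw [he']; exact neg_nonpos.2 (by positivity))
    calc ‖x (j + 1) - l‖ ≤ N * Δ j ^ (1 - θ) := htail j (by omega)
      _ ≤ N * (c / 2 * ((j + 1 : ℕ) : ℝ)) ^ e := by rw [h4]; gcongr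
      _ = _ := by rw [Real.mul_rpow (by positivity) (by positivity)]; ring

/-! ### Real parts, subgradients and smoothness of the data -/

set_option linter.unusedSectionVars false

variable {X : Type*} [NormedAddCommGroup X] [InnerProductSpace ℝ X]

/-- The real-valued part of an extended real-valued function. -/
def realPart (h : X → EReal) (x : X) : ℝ := (h x).toReal

lemma coe_realPart {h : X → EReal} (hh : IsProper h) {x : X} (hx : x ∈ dom h) :
    ((realPart h x : ℝ) : EReal) = h x :=
  EReal.coe_toReal (ne_of_lt hx) (hh.1 x)

lemma eq_top_of_notMem_dom {h : X → EReal} {x : X} (hx : x ∉ dom h) : h x = ⊤ :=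
  not_lt_top_iff.1 hx

lemma regularSubdiff_subset_subdiff (h : X → EReal) (x : X) :
    regularSubdiff h x ⊆ subdiff h x := fun v hv =>
  ⟨hv.1, hv.2.1, fun _ => x, fun _ => v, tendsto_const_nhds, tendsto_const_nhds, fun _ => hv,
    tendsto_const_nhds⟩

lemma IsConvex.convexOn_realPart {g : X → EReal} (hg : IsProper g) (hc : IsConvex g) :
    ConvexOn ℝ (dom g) (realPart g) := by
  have key : ∀ x ∈ dom g, ∀ y ∈ dom g, ∀ a b : ℝ, 0 < a → 0 < b → a + b = 1 →
      g (a • x + b • y) ≤ ((a * realPart g x + b * realPart g y : ℝ) : EReal) := by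
    intro x hx y hy a b ha hb hab
    have := hc x y a b ha hb hab
    rw [← coe_realPart hg hx, ← coe_realPart hg hy] at this
    exact_mod_cast this
  have hdom : Convex ℝ (dom g) := by
    rw [convex_iff_forall_pos]
    intro x hx y hy a b ha hb hab
    exact (key x hx y hy a b ha hb hab).trans_lt (EReal.coe_lt_top _)
  rw [convexOn_iff_forall_pos]
  refine ⟨hdom, fun x hx y hy a b ha hb hab => ?_⟩
  have h1 := key x hx y hy a b ha hb hab
  have h2 := hdom hx hy ha.le hb.le hab
  rw [← coe_realPart hg h2] at h1
  exact_mod_cast h1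

/-- A subgradient of the real part on the domain is a regular subgradient. -/
lemma mem_regularSubdiff_of_subgradient {g : X → EReal} (hg : IsProper g) {x v : X}
    (hx : x ∈ dom g)
    (hv : ∀ z ∈ dom g, realPart g x + inner ℝ v (z - x) ≤ realPart g z) :
    v ∈ regularSubdiff g x := by
  refine ⟨ne_of_lt hx, hg.1 x, fun η hη => Eventually.of_forall fun z => ?_⟩
  by_cases hz : z ∈ dom g
  · rw [← coe_realPart hg hx, ← coe_realPart hg hz]
    have := hv z hz
    have : 0 ≤ η * ‖z - x‖ := by positivity
    norm_cast
    linarith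
  · rw [eq_top_of_notMem_dom hz]; exact le_top

variable [FiniteDimensional ℝ X] {f g : X → EReal} {O : Set X}


lemma BasicAssumption.dom_subset (h : BasicAssumption f g O) : dom g ⊆ O :=
  subset_closure.trans h.closure_dom_subset

lemma BasicAssumption.coe_f (h : BasicAssumption f g O) {x : X} (hx : x ∈ O) :
    ((realPart f x : ℝ) : EReal) = f x := coe_realPart h.proper_f (h.finite_f hx)

lemma BasicAssumption.objective_eq (h : BasicAssumption f g O) {x : X} (hx : x ∈ dom g) :
    objective f g x = ((realPart f x + realPart g x : ℝ) : EReal) := by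
  rw [objective, ← h.coe_f (h.dom_subset hx), ← coe_realPart h.proper_g hx, EReal.coe_add]

lemma BasicAssumption.objective_eq_top (h : BasicAssumption f g O) {x : X} (hx : x ∉ dom g) :
    objective f g x = ⊤ := by
  rw [objective, eq_top_of_notMem_dom hx, EReal.add_top_of_ne_bot (h.proper_f.1 x)]

lemma BasicAssumption.model_eq (h : BasicAssumption f g O) (G : X →L[ℝ] X) {x z : X}
    (hx : x ∈ dom g) (hz : z ∈ dom g) :
    model f g G x z = ((realPart f x + (inner ℝ (grad f x) (z - x) +
      1 / 2 * inner ℝ (z - x) (G (z - x))) + realPart g z : ℝ) : EReal) := by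
  rw [model, ← h.coe_f (h.dom_subset hx), ← coe_realPart h.proper_g hz]
  norm_cast

lemma BasicAssumption.mem_dom_of_model_lt_top (h : BasicAssumption f g O) {G : X →L[ℝ] X}
    {x z : X} (hx : x ∈ dom g) (hz : model f g G x z < ⊤) : z ∈ dom g := by
  by_contra hc
  rw [model, eq_top_of_notMem_dom hc, ← h.coe_f (h.dom_subset hx), ← EReal.coe_add,
    EReal.coe_add_top] at hz
  exact lt_irrefl _ hz

lemma BasicAssumption.hasGradientAt (h : BasicAssumption f g O) {x : X} (hx : x ∈ O) :
    HasGradientAt (realPart f) (grad f x) x :=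
  ((h.contDiffOn_f.differentiableOn (by norm_num)).differentiableAt
    (h.isOpen_O.mem_nhds hx)).hasGradientAt

/-- The derivative of a `C²` function is locally Lipschitz, and compactness makes the constant
uniform even when `K` is not convex. The gradient inherits it through the Riesz isometry. -/
lemma BasicAssumption.exists_lipschitz_grad (h : BasicAssumption f g O) {K : Set X}
    (hK : IsCompact K) (hKO : K ⊆ O) :
    ∃ L : ℝ, 0 < L ∧ ∀ u ∈ K, ∀ v ∈ K, ‖grad f u - grad f v‖ ≤ L * ‖u - v‖ := by
  have h1 : ContDiffOn ℝ 1 (fderiv ℝ (realPart f)) O :=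
    h.contDiffOn_f.fderiv_of_isOpen h.isOpen_O (by norm_num)
  have h2 : LocallyLipschitzOn K (fderiv ℝ (realPart f)) := by
    intro x hx
    obtain ⟨C, t, ht, hC⟩ :=
      ((h1.contDiffAt (h.isOpen_O.mem_nhds (hKO hx))).exists_lipschitzOnWith)
    exact ⟨C, t, mem_nhdsWithin_of_mem_nhds ht, hC⟩
  obtain ⟨C, hC⟩ := h2.exists_lipschitzOnWith_of_compact hK
  refine ⟨C + 1, by positivity, fun u hu v hv => ?_⟩
  have h3 := hC.dist_le_mul u hu v hv
  have h4 : ‖grad f u - grad f v‖ = dist (fderiv ℝ (realPart f) u) (fderiv ℝ (realPart f) v) := by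
    rw [← dist_eq_norm]
    exact (InnerProductSpace.toDual ℝ X).symm.dist_map _ _
  rw [h4, ← dist_eq_norm]
  exact h3.trans (by gcongr; linarith)

/-- The descent lemma. -/
lemma BasicAssumption.abs_sub_sub_inner_le (h : BasicAssumption f g O) {K : Set X}
    (hK : Convex ℝ K) (hKO : K ⊆ O) {L : ℝ} (hL0 : 0 ≤ L)
    (hL : ∀ u ∈ K, ∀ v ∈ K, ‖grad f u - grad f v‖ ≤ L * ‖u - v‖)
    {u v : X} (hu : u ∈ K) (hv : v ∈ K) :
    |realPart f v - realPart f u - inner ℝ (grad f u) (v - u)| ≤ L * ‖v - u‖ ^ 2 := by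
  have hseg : segment ℝ u v ⊆ K := hK.segment_subset hu hv
  -- The mean value inequality on the segment, with the derivative at `u` subtracted, gives the
  -- constant `L` in place of the sharp `L / 2`; this suffices throughout.
  have h1 := Convex.norm_image_sub_le_of_norm_hasFDerivWithin_le' (𝕜 := ℝ) (f := realPart f)
    (f' := fun z => InnerProductSpace.toDual ℝ X (grad f z)) (s := segment ℝ u v)
    (φ := InnerProductSpace.toDual ℝ X (grad f u)) (C := L * ‖v - u‖) (x := u) (y := v)
    (fun z hz => (h.hasGradientAt (hKO (hseg hz))).hasFDerivAt.hasFDerivWithinAt)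
    (fun z hz => by
      rw [← map_sub, LinearIsometryEquiv.norm_map]
      refine (hL z (hseg hz) u hu).trans ?_
      gcongr
      have h2 := (convex_closedBall u ‖v - u‖).segment_subset (x := u) (y := v)
        (Metric.mem_closedBall_self (norm_nonneg _)) (by simp [dist_eq_norm]) hz
      simpa [dist_eq_norm] using h2)
    (convex_segment u v) (left_mem_segment ℝ u v) (right_mem_segment ℝ u v)
  simpa [Real.norm_eq_abs, sq, mul_assoc] using h1

/-- The sum rule for a smooth function and a convex subgradient. -/
lemma BasicAssumption.grad_add_mem_regularSubdiff (h : BasicAssumption f g O) {x v : X}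
    (hx : x ∈ dom g)
    (hv : ∀ z ∈ dom g, realPart g x + inner ℝ v (z - x) ≤ realPart g z) :
    grad f x + v ∈ regularSubdiff (objective f g) x := by
  rw [regularSubdiff, Set.mem_ofPred_eq, h.objective_eq hx]
  refine ⟨EReal.coe_ne_top _, EReal.coe_ne_bot _, fun η hη => ?_⟩
  have h1 := (hasGradientAt_iff_isLittleO.1 (h.hasGradientAt (h.dom_subset hx))).def hη
  filter_upwards [h1] with z hz
  by_cases hzd : z ∈ dom g
  · rw [h.objective_eq hzd]
    have h2 := hv z hzd
    have h3 := neg_le_of_abs_le hz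
    norm_cast
    rw [inner_add_left]
    linarith
  · rw [h.objective_eq_top hzd]; exact le_top

/-! ### Optimality and growth for the quadratic models -/

/-- Divide by `t` and let `t` decrease to `0`; this extracts first-order conditions from minimality
along a segment. -/
lemma nonneg_of_forall_mul_add_sq {a b : ℝ} (h : ∀ t : ℝ, 0 < t → t < 1 → 0 ≤ t * a + t ^ 2 * b) :
    0 ≤ a := by
  have h1 : ∀ᶠ t : ℝ in 𝓝[>] 0, 0 ≤ a + t * b := by
    filter_upwards [Ioo_mem_nhdsGT (zero_lt_one' ℝ)] with t ht
    have := h t ht.1 ht.2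
    have h2 : 0 ≤ t * (a + t * b) := by linarith
    exact nonneg_of_mul_nonneg_right h2 ht.1
  have h2 : Tendsto (fun t : ℝ => a + t * b) (𝓝[>] 0) (𝓝 a) := by
    have : Tendsto (fun t : ℝ => a + t * b) (𝓝 0) (𝓝 (a + 0 * b)) :=
      Continuous.tendsto (by fun_prop) 0
    rw [zero_mul, add_zero] at this
    exact this.mono_left nhdsWithin_le_nhds
  exact ge_of_tendsto h2 h1

/-- The optimality condition of a strongly convex quadratic model. -/
lemma subgradient_of_isMin_model {γ : X → ℝ} {C : Set X} (hγ : ConvexOn ℝ C γ) {G : X →L[ℝ] X}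
    (hG : IsSelfAdjoint G) {p x w : X} (hw : w ∈ C)
    (hmin : ∀ z ∈ C, inner ℝ p (w - x) + 1 / 2 * inner ℝ (w - x) (G (w - x)) + γ w ≤
      inner ℝ p (z - x) + 1 / 2 * inner ℝ (z - x) (G (z - x)) + γ z) :
    ∀ z ∈ C, γ w + inner ℝ (-p - G (w - x)) (z - w) ≤ γ z := by
  intro z hz
  suffices 0 ≤ inner ℝ p (z - w) + inner ℝ (G (w - x)) (z - w) + (γ z - γ w) by
    rw [inner_sub_left, inner_neg_left]; linarith
  apply nonneg_of_forall_mul_add_sq (b := 1 / 2 * inner ℝ (z - w) (G (z - w)))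
  intro t ht0 ht1
  have h1 : (1 - t) • w + t • z ∈ C := hγ.1 hw hz (by linarith) ht0.le (by ring)
  have h2 := hγ.2 hw hz (by linarith : 0 ≤ 1 - t) ht0.le (by ring)
  have h3 := hmin _ h1
  have h4 : (1 - t) • w + t • z - x = (w - x) + t • (z - w) := by module
  have h5 : inner ℝ (w - x) (G (z - w)) = inner ℝ (G (w - x)) (z - w) :=
    (ContinuousLinearMap.isSelfAdjoint_iff_isSymmetric.1 hG (w - x) (z - w)).symm
  have h6 : inner ℝ (z - w) (G (w - x)) = inner ℝ (G (w - x)) (z - w) := real_inner_comm _ _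
  rw [h4] at h3
  simp only [map_add, map_smul, inner_add_left, inner_add_right, real_inner_smul_left,
    real_inner_smul_right, smul_eq_mul, h5, h6] at h3 h2
  linarith

/-- Quadratic growth of the model around its minimizer. -/
lemma model_growth {γ : X → ℝ} {C : Set X} {G : X →L[ℝ] X}
    (hG : IsSelfAdjoint G) {p x w : X}
    (hsub : ∀ z ∈ C, γ w + inner ℝ (-p - G (w - x)) (z - w) ≤ γ z) {z : X} (hz : z ∈ C) :
    inner ℝ p (w - x) + 1 / 2 * inner ℝ (w - x) (G (w - x)) + γ w +
      1 / 2 * inner ℝ (z - w) (G (z - w)) ≤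
      inner ℝ p (z - x) + 1 / 2 * inner ℝ (z - x) (G (z - x)) + γ z := by
  have h1 := hsub z hz
  have h4 : z - x = (w - x) + (z - w) := by abel
  have h5 : inner ℝ (w - x) (G (z - w)) = inner ℝ (G (w - x)) (z - w) :=
    (ContinuousLinearMap.isSelfAdjoint_iff_isSymmetric.1 hG (w - x) (z - w)).symm
  have h6 : inner ℝ (z - w) (G (w - x)) = inner ℝ (G (w - x)) (z - w) := real_inner_comm _ _
  rw [h4]
  simp only [map_add, inner_add_left, inner_add_right, h5, h6]
  rw [inner_sub_left, inner_neg_left] at h1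
  linarith

variable {μ β σ : ℝ} {ε : ℕ → ℝ}
  {G : ℕ → X →L[ℝ] X} {x y : ℕ → X} {m : ℕ → ℕ}

/-- The real-valued part of the objective on the domain of `g`. -/
def realObjective (f g : X → EReal) (x : X) : ℝ := realPart f x + realPart g x

/-- The limit of the objective values. -/
noncomputable def limitValue (f g : X → EReal) (x : ℕ → X) : ℝ := ⨅ k, realObjective f g (x k)

/-! ### Descent and boundedness along the iterates -/

namespace IsVMiPGSequence

lemma mem_dom_of_mem (hs : IsVMiPGSequence f g μ β σ ε G x y m) (h : BasicAssumption f g O) {k : ℕ}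
    (hx : x k ∈ dom g) : y k ∈ dom g :=
  h.mem_dom_of_model_lt_top hx ((hs.model_decrease k).trans_le le_top)

lemma β_pow_pos (hs : IsVMiPGSequence f g μ β σ ε G x y m) (j : ℕ) : 0 < β ^ j :=
  pow_pos hs.β_pos j

lemma β_pow_le_one (hs : IsVMiPGSequence f g μ β σ ε G x y m) (j : ℕ) : β ^ j ≤ 1 :=
  pow_le_one₀ hs.β_pos.le hs.β_lt_one.le

lemma segment_mem (hs : IsVMiPGSequence f g μ β σ ε G x y m) {C : Set X} (hC : Convex ℝ C) {k : ℕ}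
    (hx : x k ∈ C) (hy : y k ∈ C) (j : ℕ) : x k + β ^ j • (y k - x k) ∈ C :=
  hC.add_smul_sub_mem hx hy ⟨(hs.β_pow_pos j).le, hs.β_pow_le_one j⟩

lemma x_mem_dom (hs : IsVMiPGSequence f g μ β σ ε G x y m) (h : BasicAssumption f g O) (k : ℕ) :
    x k ∈ dom g := by
  induction k with
  | zero => exact hs.x_zero_mem
  | succ k ih =>
    by_cases hc : objective f g (y k) < objective f g (x k + β ^ m k • (y k - x k))
    · rw [hs.next_full k hc]; exact hs.mem_dom_of_mem h ih
    · rw [hs.next_armijo k hc]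
      exact hs.segment_mem (h.convex_g.convexOn_realPart h.proper_g).1 ih
        (hs.mem_dom_of_mem h ih) _

lemma y_mem_dom (hs : IsVMiPGSequence f g μ β σ ε G x y m) (h : BasicAssumption f g O) (k : ℕ) :
    y k ∈ dom g := hs.mem_dom_of_mem h (hs.x_mem_dom h k)

lemma trial_mem_dom (hs : IsVMiPGSequence f g μ β σ ε G x y m) (h : BasicAssumption f g O)
    (k j : ℕ) : x k + β ^ j • (y k - x k) ∈ dom g :=
  hs.segment_mem (h.convex_g.convexOn_realPart h.proper_g).1 (hs.x_mem_dom h k)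
    (hs.y_mem_dom h k) j

/-- The form in which the model decrease is used below, with the metric replaced by its lower bound.
-/
lemma inner_add_lt (hs : IsVMiPGSequence f g μ β σ ε G x y m) (h : BasicAssumption f g O) (k : ℕ) :
    inner ℝ (grad f (x k)) (y k - x k) + μ / 2 * ‖y k - x k‖ ^ 2 + realPart g (y k) <
      realPart g (x k) := by
  have h1 := hs.model_decrease k
  rw [h.model_eq _ (hs.x_mem_dom h k) (hs.y_mem_dom h k),
    h.model_eq _ (hs.x_mem_dom h k) (hs.x_mem_dom h k), EReal.coe_lt_coe_iff] at h1
  simp only [sub_self, inner_zero_right, map_zero, mul_zero, add_zero] at h1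
  linarith [hs.G_ge k (y k - x k)]

lemma norm_sub_pos (hs : IsVMiPGSequence f g μ β σ ε G x y m) (h : BasicAssumption f g O) (k : ℕ) :
    0 < ‖y k - x k‖ := by
  rw [norm_pos_iff]
  intro hc
  have h1 := hs.inner_add_lt h k
  rw [hc, sub_eq_zero.1 hc] at h1
  simp at h1

/-- The minimizer comes with its optimality condition, its distance to `y k` (quadratic growth
against the inexactness test), and a comparison of model values in which the metric at `y k` is
bounded below by `μ`. -/
lemma exists_minimizer (hs : IsVMiPGSequence f g μ β σ ε G x y m) (h : BasicAssumption f g O)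
    (k : ℕ) : ∃ w ∈ dom g,
      (∀ z ∈ dom g, realPart g w + inner ℝ (-grad f (x k) - G k (w - x k)) (z - w) ≤
        realPart g z) ∧
      μ / 2 * ‖y k - w‖ ^ 2 ≤ ε k * ‖y k - x k‖ ^ 2 ∧
      inner ℝ (grad f (x k)) (y k - x k) + μ / 2 * ‖y k - x k‖ ^ 2 + realPart g (y k) ≤
        inner ℝ (grad f (x k)) (w - x k) + 1 / 2 * inner ℝ (w - x k) (G k (w - x k)) +
          realPart g w + ε k * ‖y k - x k‖ ^ 2 := by
  have hx := hs.x_mem_dom h k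
  have hy := hs.y_mem_dom h k
  obtain ⟨w, hw, hyw⟩ := hs.inexact k
  have hwd : w ∈ dom g := by
    refine h.mem_dom_of_model_lt_top hx ((hw (x k)).trans_lt ?_)
    rw [h.model_eq _ hx hx]; exact EReal.coe_lt_top _
  have hmin : ∀ z ∈ dom g, inner ℝ (grad f (x k)) (w - x k) +
      1 / 2 * inner ℝ (w - x k) (G k (w - x k)) + realPart g w ≤
      inner ℝ (grad f (x k)) (z - x k) + 1 / 2 * inner ℝ (z - x k) (G k (z - x k)) +
        realPart g z := fun z hz => by
    have h1 := hw z
    rw [h.model_eq _ hx hwd, h.model_eq _ hx hz, EReal.coe_le_coe_iff] at h1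
    linarith
  rw [h.model_eq _ hx hwd, h.model_eq _ hx hy, ← EReal.coe_add, EReal.coe_le_coe_iff] at hyw
  have hsub := subgradient_of_isMin_model (h.convex_g.convexOn_realPart h.proper_g)
    (hs.G_selfAdjoint k) hwd hmin
  have hgr := model_growth (hs.G_selfAdjoint k) hsub hy
  have h1 := hs.G_ge k (y k - w)
  have h2 := hs.G_ge k (y k - x k)
  exact ⟨w, hwd, hsub, by linarith, by linarith⟩

/-- The optimality condition of the first model already supplies a subgradient of `g`, so no
separation argument is needed. -/
lemma exists_affine_minorant (hs : IsVMiPGSequence f g μ β σ ε G x y m)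
    (h : BasicAssumption f g O) :
    ∃ (v : X) (b : ℝ), ∀ z ∈ dom g, b + inner ℝ v z ≤ realPart g z := by
  obtain ⟨w, -, hw, -⟩ := hs.exists_minimizer h 0
  refine ⟨-grad f (x 0) - G 0 (w - x 0),
    realPart g w - inner ℝ (-grad f (x 0) - G 0 (w - x 0)) w, fun z hz => ?_⟩
  have := hw z hz
  rw [inner_sub_right] at this
  linarith

lemma armijo (hs : IsVMiPGSequence f g μ β σ ε G x y m) (h : BasicAssumption f g O) (k j : ℕ) :
    ArmijoTest f g β σ (x k) (y k - x k) j ↔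
      realObjective f g (x k + β ^ j • (y k - x k)) + σ * β ^ j * ‖y k - x k‖ ^ 2 ≤
        realObjective f g (x k) := by
  rw [ArmijoTest, h.objective_eq (hs.trial_mem_dom h k j), h.objective_eq (hs.x_mem_dom h k),
    ← EReal.coe_add, EReal.coe_le_coe_iff]
  rfl

/-- The update selects the better of `y k` and the line-search point, so both comparisons hold in
either case. -/
lemma next_cases (hs : IsVMiPGSequence f g μ β σ ε G x y m) (h : BasicAssumption f g O) (k : ℕ) :
    realObjective f g (x (k + 1)) ≤ realObjective f g (y k) ∧
    realObjective f g (x (k + 1)) ≤ realObjective f g (x k + β ^ m k • (y k - x k)) ∧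
    ‖x (k + 1) - x k‖ ≤ ‖y k - x k‖ := by
  have hobj : objective f g (y k) < objective f g (x k + β ^ m k • (y k - x k)) ↔
      realObjective f g (y k) < realObjective f g (x k + β ^ m k • (y k - x k)) := by
    rw [h.objective_eq (hs.trial_mem_dom h k _), h.objective_eq (hs.y_mem_dom h k),
      EReal.coe_lt_coe_iff]
    rfl
  by_cases hc : objective f g (y k) < objective f g (x k + β ^ m k • (y k - x k))
  · rw [hs.next_full k hc]
    exact ⟨le_rfl, (hobj.1 hc).le, le_rfl⟩
  · rw [hs.next_armijo k hc]
    rw [hobj, not_lt] at hc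
    refine ⟨hc, le_rfl, ?_⟩
    rw [add_sub_cancel_left, norm_smul, Real.norm_of_nonneg (hs.β_pow_pos _).le]
    exact mul_le_of_le_one_left (norm_nonneg _) (hs.β_pow_le_one _)

lemma decrease (hs : IsVMiPGSequence f g μ β σ ε G x y m) (h : BasicAssumption f g O) (k : ℕ) :
    σ * β ^ m k * ‖y k - x k‖ ^ 2 ≤ realObjective f g (x k) - realObjective f g (x (k + 1)) := by
  have h1 := (hs.armijo h k (m k)).1 (hs.line_search k).1
  have h2 := (hs.next_cases h k).2.1
  linarith

lemma σ_lt_half (hs : IsVMiPGSequence f g μ β σ ε G x y m) : σ < μ / 2 := by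
  have h1 := hs.σ_lt
  have h2 : min 1 μ ≤ μ := min_le_right _ _
  linarith

lemma antitone_objective (hs : IsVMiPGSequence f g μ β σ ε G x y m) (h : BasicAssumption f g O) :
    Antitone fun k => realObjective f g (x k) := by
  refine antitone_nat_of_succ_le fun k => ?_
  have h1 := hs.decrease h k
  have h2 : 0 ≤ σ * β ^ m k * ‖y k - x k‖ ^ 2 := by
    have := hs.σ_pos; have := hs.β_pow_pos (m k)
    positivity
  linarith

lemma bddBelow_objective (hs : IsVMiPGSequence f g μ β σ ε G x y m) (h : BasicAssumption f g O) :
    BddBelow (Set.range fun k => realObjective f g (x k)) := by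
  obtain ⟨c, hc⟩ := h.bddBelow_F
  refine ⟨c, ?_⟩
  rintro _ ⟨k, rfl⟩
  have := hc (x k)
  rw [h.objective_eq (hs.x_mem_dom h k), EReal.coe_le_coe_iff] at this
  exact this

lemma tendsto_limitValue (hs : IsVMiPGSequence f g μ β σ ε G x y m) (h : BasicAssumption f g O) :
    Tendsto (fun k => realObjective f g (x k)) atTop (𝓝 (limitValue f g x)) :=
  tendsto_atTop_ciInf (hs.antitone_objective h) (hs.bddBelow_objective h)

/-- Step sizes are bounded below on sets where the gradient is Lipschitz. -/
lemma step_size_ge (hs : IsVMiPGSequence f g μ β σ ε G x y m) (h : BasicAssumption f g O)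
    {K : Set X} (hK : Convex ℝ K) (hKO : K ⊆ O) {L : ℝ} (hL0 : 0 < L)
    (hL : ∀ u ∈ K, ∀ v ∈ K, ‖grad f u - grad f v‖ ≤ L * ‖u - v‖) {k : ℕ}
    (hx : x k ∈ K) (hy : y k ∈ K) : min 1 (β * ((μ / 2 - σ) / L)) ≤ β ^ m k := by
  rcases hm : m k with _ | j
  · simp
  -- If the accepted exponent is `j + 1`, the test failed at `j`. With the descent lemma and
  -- convexity of `g`, failure forces `μ / 2 - σ ≤ L * β ^ j`.
  have hnot : ¬ ArmijoTest f g β σ (x k) (y k - x k) j := fun hc => by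
    have := (hs.line_search k).2 hc
    omega
  rw [hs.armijo h, not_le] at hnot
  have ht := hs.segment_mem hK hx hy j
  set t := β ^ j with htdef
  have ht0 : 0 < t := hs.β_pow_pos j
  have h1 := (abs_le.1 (h.abs_sub_sub_inner_le hK hKO hL0.le hL hx ht)).2
  have h2 := (h.convex_g.convexOn_realPart h.proper_g).2 (hs.x_mem_dom h k) (hs.y_mem_dom h k)
    (by linarith [hs.β_pow_le_one j] : 0 ≤ 1 - t) ht0.le (by ring)
  rw [show (1 - t) • x k + t • y k = x k + t • (y k - x k) by module] at h2
  have h3 := hs.inner_add_lt h k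
  have hd := hs.norm_sub_pos h k
  rw [add_sub_cancel_left, real_inner_smul_right, norm_smul, Real.norm_of_nonneg ht0.le] at h1
  simp only [realObjective, smul_eq_mul] at hnot h2
  have h4 : t * (μ / 2 - σ) * ‖y k - x k‖ ^ 2 ≤ t * (L * t) * ‖y k - x k‖ ^ 2 := by
    have := mul_lt_mul_of_pos_left h3 ht0
    nlinarith
  have h5 : μ / 2 - σ ≤ L * t :=
    le_of_mul_le_mul_left (le_of_mul_le_mul_right h4 (by positivity)) ht0
  refine (min_le_right _ _).trans ?_
  rw [pow_succ', ← htdef]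
  have := hs.β_pos
  gcongr
  rw [div_le_iff₀ hL0]; linarith

/-- The directions are bounded along a bounded sequence of iterates. -/
lemma exists_norm_sub_le (hs : IsVMiPGSequence f g μ β σ ε G x y m) (h : BasicAssumption f g O)
    (hb : Bornology.IsBounded (Set.range x)) : ∃ D : ℝ, ∀ k, ‖y k - x k‖ ≤ D := by
  obtain ⟨R, hR⟩ := hb.exists_norm_le
  have hR' : ∀ k, ‖x k‖ ≤ R := fun k => hR _ ⟨k, rfl⟩
  -- Only the iterates `x k` are known to be bounded at this stage, so the gradient and the lower
  -- bound on `f` are controlled on their closure alone.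
  have hK : IsCompact (closure (Set.range x)) := hb.isCompact_closure
  have hKO : closure (Set.range x) ⊆ O :=
    (closure_mono (Set.range_subset_iff.2 (hs.x_mem_dom h))).trans h.closure_dom_subset
  have hxK : ∀ k, x k ∈ closure (Set.range x) := fun k => subset_closure ⟨k, rfl⟩
  obtain ⟨L, hL0, hL⟩ := h.exists_lipschitz_grad hK hKO
  have hcf : ContinuousOn (realPart f) (closure (Set.range x)) := fun z hz =>
    (h.hasGradientAt (hKO hz)).continuousAt.continuousWithinAt
  obtain ⟨c, hc⟩ := (hK.image_of_continuousOn hcf).bddBelow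
  have hc' : ∀ k, c ≤ realPart f (x k) := fun k => hc ⟨x k, hxK k, rfl⟩
  obtain ⟨v, b, hvb⟩ := hs.exists_affine_minorant h
  set B := ‖grad f (x 0)‖ + L * (R + R) with hB
  have hgB : ∀ k, ‖grad f (x k)‖ ≤ B := fun k => by
    have h1 := hL _ (hxK k) _ (hxK 0)
    have h2 : ‖x k - x 0‖ ≤ R + R := (norm_sub_le _ _).trans (add_le_add (hR' _) (hR' _))
    have h3 : ‖grad f (x k)‖ ≤ ‖grad f (x 0)‖ + ‖grad f (x k) - grad f (x 0)‖ := by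
      rw [add_comm]; exact norm_le_norm_sub_add _ _
    calc _ ≤ _ := h3
      _ ≤ ‖grad f (x 0)‖ + L * ‖x k - x 0‖ := by gcongr
      _ ≤ _ := by rw [hB]; gcongr
  set P := |realObjective f g (x 0) - c - b| + ‖v‖ * R with hP
  set Q := B + ‖v‖ with hQ
  have hμ := hs.μ_pos
  -- The model decrease and the affine minorant give `μ / 2 * ‖d‖ ^ 2 ≤ P + Q * ‖d‖`; for `‖d‖ ≥ 1`
  -- the right side is at most `(P + Q) * ‖d‖`.
  refine ⟨max 1 ((P + Q) / (μ / 2)), fun k => ?_⟩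
  rcases le_total ‖y k - x k‖ 1 with h1 | h1
  · exact h1.trans (le_max_left _ _)
  refine le_trans ?_ (le_max_right _ _)
  rw [le_div_iff₀ (by positivity)]
  have h2 := hs.inner_add_lt h k
  have h3 := hvb (y k) (hs.y_mem_dom h k)
  have h4 : realPart g (x k) ≤ realObjective f g (x 0) - c := by
    have := hs.antitone_objective h (Nat.zero_le k)
    simp only [realObjective] at this ⊢
    linarith [hc' k]
  have h5 := neg_le_of_abs_le (abs_real_inner_le_norm (grad f (x k)) (y k - x k))
  have h6 := neg_le_of_abs_le (abs_real_inner_le_norm v (y k - x k))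
  have h7 := neg_le_of_abs_le (abs_real_inner_le_norm v (x k))
  have h8 : inner ℝ v (y k) = inner ℝ v (x k) + inner ℝ v (y k - x k) := by
    rw [← inner_add_right]; congr 1; abel
  have h9 : ‖grad f (x k)‖ * ‖y k - x k‖ ≤ B * ‖y k - x k‖ := by gcongr; exact hgB k
  have h10 : ‖v‖ * ‖x k‖ ≤ ‖v‖ * R := by gcongr; exact hR' k
  have h11 := le_abs_self (realObjective f g (x 0) - c - b)
  have h12 : μ / 2 * ‖y k - x k‖ ^ 2 ≤ P + Q * ‖y k - x k‖ := by
    rw [hP, hQ]; linarith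
  have hP0 : 0 ≤ P := by
    have := (norm_nonneg _).trans (hR' 0); positivity
  have h13 : ‖y k - x k‖ * (‖y k - x k‖ * (μ / 2)) ≤ ‖y k - x k‖ * (P + Q) := by
    nlinarith
  exact le_of_mul_le_mul_left h13 (by linarith)

end IsVMiPGSequence

/-! ### Continuity on the domain and the KL inequality in real form -/

lemma BasicAssumption.continuousOn_realPart (h : BasicAssumption f g O) :
    ContinuousOn (realPart g) (dom g) := fun z hz =>
  (EReal.tendsto_toReal (ne_of_lt hz) (h.proper_g.1 z)).comp (h.continuousOn_g z hz)

lemma BasicAssumption.continuousOn_realObjective (h : BasicAssumption f g O) :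
    ContinuousOn (realObjective f g) (dom g) := fun z hz =>
  ((h.hasGradientAt (h.dom_subset hz)).continuousAt.continuousWithinAt).add
    (h.continuousOn_realPart z hz)

/-- The Kurdyka-Łojasiewicz inequality in real terms near a point of the domain. -/
lemma BasicAssumption.exists_rpow_le_of_hasKLExponentAt (h : BasicAssumption f g O) {θ : ℝ}
    (hθ : θ < 1) {z : X} (hz : z ∈ dom g) (hKL : HasKLExponentAt (objective f g) θ z) :
    ∃ ρ : ℝ, 0 < ρ ∧ ∃ C : ℝ, 0 < C ∧ ∀ u ∈ dom g, ‖u - z‖ < ρ →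
      realObjective f g z < realObjective f g u → ∀ v ∈ subdiff (objective f g) u,
        (realObjective f g u - realObjective f g z) ^ θ ≤ C * ‖v‖ := by
  obtain ⟨δ, hδ, ϖ, hϖ, c, hc, hKL⟩ := hKL
  -- As `ϖ` may be infinite, a real `r` below it is chosen. Relative continuity of `F` then makes
  -- the upper level condition automatic near `z`.
  obtain ⟨r, hr0, hr⟩ := EReal.lt_iff_exists_real_btwn.1 hϖ
  have hr0' : (0 : ℝ) < r := by exact_mod_cast hr0
  have hcont := (Metric.continuousWithinAt_iff.1 (h.continuousOn_realObjective z hz)) r hr0'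
  obtain ⟨ρ, hρ, hρr⟩ := hcont
  refine ⟨min ρ δ, lt_min hρ hδ, c * (1 - θ), mul_pos hc (by linarith),
    fun u hu hud hlt v hv => ?_⟩
  have h1 := hρr hu (by rw [dist_eq_norm]; exact hud.trans_le (min_le_left _ _))
  have h2 : realObjective f g u < realObjective f g z + r := by
    rw [Real.dist_eq, abs_lt] at h1; linarith
  have h3 := hKL u (by rw [mem_closedBall_iff_norm]; exact (hud.trans_le (min_le_right _ _)).le)
  rw [h.objective_eq hu, h.objective_eq hz] at h3
  have h4 := h3 (by exact_mod_cast hlt) (by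
    calc ((realPart f u + realPart g u : ℝ) : EReal)
        < ((realPart f z + realPart g z + r : ℝ) : EReal) := by exact_mod_cast h2
      _ = ((realPart f z + realPart g z : ℝ) : EReal) + (r : EReal) := EReal.coe_add _ _
      _ ≤ _ := by gcongr)
  rw [EReal.toReal_coe, EReal.toReal_coe] at h4
  change 1 ≤ ENNReal.ofReal (deriv (fun t : ℝ => c * t ^ (1 - θ))
    (realObjective f g u - realObjective f g z)) * _ at h4
  set s := realObjective f g u - realObjective f g z with hs
  have hs0 : 0 < s := by linarith
  have hder : deriv (fun t : ℝ => c * t ^ (1 - θ)) s = c * (1 - θ) * (s ^ θ)⁻¹ := by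
    rw [((Real.hasDerivAt_rpow_const (p := 1 - θ) (Or.inl hs0.ne')).const_mul c).deriv,
      show 1 - θ - 1 = -θ by ring, Real.rpow_neg hs0.le, mul_assoc]
  have hsθ : 0 < s ^ θ := Real.rpow_pos_of_pos hs0 θ
  have hpos : 0 ≤ c * (1 - θ) * (s ^ θ)⁻¹ :=
    mul_nonneg (mul_nonneg hc.le (by linarith)) (inv_nonneg.2 hsθ.le)
  have h5 : (1 : ℝ≥0∞) ≤ ENNReal.ofReal (c * (1 - θ) * (s ^ θ)⁻¹ * ‖v‖) := by
    rw [ENNReal.ofReal_mul hpos, ← hder]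
    refine h4.trans ?_
    gcongr
    refine (Metric.infEDist_le_edist_of_mem hv).trans_eq ?_
    rw [edist_dist, dist_zero_left]
  have h6 := ENNReal.one_le_ofReal.1 h5
  calc s ^ θ = s ^ θ * 1 := (mul_one _).symm
    _ ≤ s ^ θ * (c * (1 - θ) * (s ^ θ)⁻¹ * ‖v‖) := by gcongr
    _ = _ := by field_simp

/-! ### Cluster points and a uniform KL constant -/

namespace IsVMiPGSequence

/-- A cluster point of the iterates lies in the domain, attains the limit value and is
stationary. -/
lemma mem_stationarySet_of_tendsto (hs : IsVMiPGSequence f g μ β σ ε G x y m)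
    (h : BasicAssumption f g O) {μbar : ℝ} (hG : ∀ k, ‖G k‖ ≤ μbar) {w : ℕ → X}
    (hw : ∀ k, w k ∈ dom g)
    (hsub : ∀ k, ∀ z ∈ dom g, realPart g (w k) +
      inner ℝ (-grad f (x k) - G k (w k - x k)) (z - w k) ≤ realPart g z)
    (hwx : Tendsto (fun k => w k - x k) atTop (𝓝 0)) {l : Filter ℕ} [l.NeBot]
    (hl : l ≤ atTop) {z : X} (hz : Tendsto x l (𝓝 z)) :
    z ∈ dom g ∧ realObjective f g z = limitValue f g x ∧
      (∀ u ∈ dom g, realPart g z + inner ℝ (-grad f z) (u - z) ≤ realPart g u) := by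
  have hzO : z ∈ O := h.closure_dom_subset
    (mem_closure_of_tendsto hz (Eventually.of_forall fun k => hs.x_mem_dom h k))
  have hfz : Tendsto (fun k => realPart f (x k)) l (𝓝 (realPart f z)) :=
    (h.hasGradientAt hzO).continuousAt.tendsto.comp hz
  have hF := (hs.tendsto_limitValue h).mono_left hl
  have hgx : Tendsto (fun k => realPart g (x k)) l (𝓝 (limitValue f g x - realPart f z)) := by
    refine (hF.sub hfz).congr fun k => ?_
    simp [realObjective]
  -- The values `g (x k) = F (x k) - f (x k)` have a finite limit, so lower semicontinuity excludes
  -- `g z = ⊤`.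
  have hzd : z ∈ dom g := by
    by_contra hc
    have h1 : ((limitValue f g x - realPart f z + 1 : ℝ) : EReal) < g z := by
      rw [eq_top_of_notMem_dom hc]; exact EReal.coe_lt_top _
    have h2 := hz.eventually (h.lsc_g z _ h1)
    have h3 := hgx.eventually (eventually_lt_nhds (lt_add_one (limitValue f g x - realPart f z)))
    obtain ⟨k, h4, h5⟩ := (h2.and h3).exists
    rw [← coe_realPart h.proper_g (hs.x_mem_dom h k), gt_iff_lt, EReal.coe_lt_coe_iff] at h4
    linarith
  have hwz : Tendsto w l (𝓝 z) := by
    have := (hwx.mono_left hl).add hz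
    simpa using this
  have hgc : ∀ u : ℕ → X, (∀ k, u k ∈ dom g) → Tendsto u l (𝓝 z) →
      Tendsto (fun k => realPart g (u k)) l (𝓝 (realPart g z)) := fun u hu hul =>
    (h.continuousOn_realPart z hzd).tendsto.comp
      (tendsto_nhdsWithin_iff.2 ⟨hul, Eventually.of_forall hu⟩)
  refine ⟨hzd, ?_, fun u hu => ?_⟩
  · have := tendsto_nhds_unique hgx (hgc x (hs.x_mem_dom h) hz)
    rw [realObjective]; linarith
  · obtain ⟨ρ, hρ, hρO⟩ := Metric.isOpen_iff.1 h.isOpen_O z hzO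
    obtain ⟨L, hL0, hL⟩ := h.exists_lipschitz_grad (isCompact_closedBall z (ρ / 2))
      ((Metric.closedBall_subset_ball (by linarith)).trans hρO)
    have hgrad : Tendsto (fun k => grad f (x k)) l (𝓝 (grad f z)) := by
      rw [tendsto_iff_norm_sub_tendsto_zero]
      have h1 : Tendsto (fun k => L * ‖x k - z‖) l (𝓝 0) := by
        simpa using (tendsto_iff_norm_sub_tendsto_zero.1 hz).const_mul L
      refine squeeze_zero' (Eventually.of_forall fun _ => norm_nonneg _) ?_ h1
      filter_upwards [hz.eventually (Metric.closedBall_mem_nhds z (half_pos hρ))] with k hk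
      exact hL _ hk _ (Metric.mem_closedBall_self (by positivity))
    have hGw : Tendsto (fun k => G k (w k - x k)) l (𝓝 0) := by
      rw [tendsto_zero_iff_norm_tendsto_zero]
      have h1 : Tendsto (fun k => μbar * ‖w k - x k‖) l (𝓝 0) := by
        simpa using ((hwx.mono_left hl).norm).const_mul μbar
      refine squeeze_zero (fun _ => norm_nonneg _) (fun k => ?_) h1
      exact (G k).le_of_opNorm_le (hG k) _
    have h1 : Tendsto (fun k => realPart g (w k) +
        inner ℝ (-grad f (x k) - G k (w k - x k)) (u - w k)) l
        (𝓝 (realPart g z + inner ℝ (-grad f z - 0) (u - z))) :=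
      (hgc w hw hwz).add ((hgrad.neg.sub hGw).inner (tendsto_const_nhds.sub hwz))
    rw [sub_zero] at h1
    exact le_of_tendsto h1 (Eventually.of_forall fun k => hsub k u hu)

lemma tendsto_norm_sub_zero (hs : IsVMiPGSequence f g μ β σ ε G x y m)
    (h : BasicAssumption f g O) {A : ℝ} (hA : 0 < A)
    (hdec : ∀ k, A * ‖y k - x k‖ ^ 2 ≤ realObjective f g (x k) - realObjective f g (x (k + 1))) :
    Tendsto (fun k => ‖y k - x k‖) atTop (𝓝 0) := by
  have h1 := hs.tendsto_limitValue h
  have h2 := (h1.sub ((tendsto_add_atTop_iff_nat 1).2 h1)).const_mul A⁻¹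
  rw [sub_self, mul_zero] at h2
  have h3 : Tendsto (fun k => ‖y k - x k‖ ^ 2) atTop (𝓝 0) := by
    refine squeeze_zero (fun _ => by positivity) (fun k => ?_) h2
    rw [inv_mul_eq_div, le_div_iff₀ hA, mul_comm]
    exact hdec k
  simpa using h3.sqrt

/-- The Kurdyka-Łojasiewicz inequality along a sequence asymptotic to the bounded iterates. -/
lemma exists_eventually_rpow_le (hs : IsVMiPGSequence f g μ β σ ε G x y m)
    (h : BasicAssumption f g O) (hb : Bornology.IsBounded (Set.range x))
    {μbar : ℝ} (hG : ∀ k, ‖G k‖ ≤ μbar) {θ : ℝ} (hθ : θ < 1)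
    (hKL : IsKLFunctionOfExponent (objective f g) θ) {w : ℕ → X}
    (hw : ∀ k, w k ∈ dom g)
    (hsub : ∀ k, ∀ z ∈ dom g, realPart g (w k) +
      inner ℝ (-grad f (x k) - G k (w k - x k)) (z - w k) ≤ realPart g z)
    (hwx : Tendsto (fun k => w k - x k) atTop (𝓝 0)) :
    ∃ C : ℝ, 0 < C ∧ ∀ᶠ k in atTop, limitValue f g x < realObjective f g (w k) →
      (realObjective f g (w k) - limitValue f g x) ^ θ ≤
        C * ‖grad f (w k) + (-grad f (x k) - G k (w k - x k))‖ := by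
  suffices ∃ C : ℝ, 0 < C ∧ ∀ᶠ k in atTop, x k ∈ closure (Set.range x) →
      limitValue f g x < realObjective f g (w k) →
      (realObjective f g (w k) - limitValue f g x) ^ θ ≤
        C * ‖grad f (w k) + (-grad f (x k) - G k (w k - x k))‖ by
    obtain ⟨C, hC, hC'⟩ := this
    exact ⟨C, hC, hC'.mono fun k hk => hk (subset_closure ⟨k, rfl⟩)⟩
  -- The property "one constant works for all large `k` with `x k ∈ s`" passes to subsets and finite
  -- unions, so it need only be checked locally.
  refine hb.isCompact_closure.induction_on (p := fun s => ∃ C : ℝ, 0 < C ∧ ∀ᶠ k in atTop,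
    x k ∈ s → limitValue f g x < realObjective f g (w k) →
      (realObjective f g (w k) - limitValue f g x) ^ θ ≤
        C * ‖grad f (w k) + (-grad f (x k) - G k (w k - x k))‖) ?_ ?_ ?_ ?_
  · exact ⟨1, one_pos, Eventually.of_forall fun k hk => absurd hk (Set.notMem_empty _)⟩
  · rintro s t hst ⟨C, hC, hC'⟩
    exact ⟨C, hC, hC'.mono fun k hk hks => hk (hst hks)⟩
  · rintro s t ⟨C, hC, hC'⟩ ⟨D, hD, hD'⟩
    refine ⟨max C D, lt_max_of_lt_left hC, ?_⟩
    filter_upwards [hC', hD'] with k hk1 hk2 hks hlt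
    rcases hks with hks | hks
    · refine (hk1 hks hlt).trans ?_
      gcongr; exact le_max_left _ _
    · refine (hk2 hks hlt).trans ?_
      gcongr; exact le_max_right _ _
  · intro z _
    by_cases hcl : MapClusterPt z atTop x
    · obtain ⟨l, hl, hz⟩ := mapClusterPt_iff_ultrafilter.1 hcl
      obtain ⟨hzd, hzF, hzs⟩ := hs.mem_stationarySet_of_tendsto h hG hw hsub hwx hl hz
      have h0 := regularSubdiff_subset_subdiff _ _ (h.grad_add_mem_regularSubdiff hzd hzs)
      obtain ⟨ρ, hρ, C, hC, hCρ⟩ := h.exists_rpow_le_of_hasKLExponentAt hθ hzd (hKL.2 z ⟨_, h0⟩)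
      refine ⟨Metric.ball z (ρ / 2), mem_nhdsWithin_of_mem_nhds
        (Metric.ball_mem_nhds z (half_pos hρ)), C, hC, ?_⟩
      filter_upwards [hwx.eventually (Metric.ball_mem_nhds 0 (half_pos hρ))] with k hk hkx hlt
      rw [dist_zero_right] at hk
      rw [mem_ball_iff_norm] at hkx
      have h1 : ‖w k - z‖ < ρ := by
        calc ‖w k - z‖ = ‖(w k - x k) + (x k - z)‖ := by rw [sub_add_sub_cancel]
          _ ≤ ‖w k - x k‖ + ‖x k - z‖ := norm_add_le _ _
          _ < ρ := by linarith
      rw [← hzF] at hlt ⊢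
      exact hCρ _ (hw k) h1 hlt _ (regularSubdiff_subset_subdiff _ _
        (h.grad_add_mem_regularSubdiff (hw k) (hsub k)))
    -- Near a point that is not a cluster point the claim is vacuous: some neighbourhood is
    -- eventually avoided.
    · rw [mapClusterPt_iff_frequently] at hcl
      push Not at hcl
      obtain ⟨t, ht, hxt⟩ := hcl
      exact ⟨t, mem_nhdsWithin_of_mem_nhds ht, 1, one_pos,
        hxt.mono fun k hk hkt => absurd hkt hk⟩

end IsVMiPGSequence

/-- Shifting a sequence does not change its linear or sublinear rate. -/
lemma rates_of_shift {E : Type*} [NormedAddCommGroup E] {x : ℕ → E} {l : E} {θ : ℝ} (hθ : 1 / 2 ≤ θ)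
    (hθ1 : θ < 1) (K : ℕ)
    (h : ∃ ϱ c₁ : ℝ, 0 < ϱ ∧ ϱ < 1 ∧ 0 < c₁ ∧
      (θ = 1 / 2 → ∀ᶠ k : ℕ in atTop, ‖x (k + K) - l‖ ≤ c₁ * ϱ ^ k) ∧
      (1 / 2 < θ → ∀ᶠ k : ℕ in atTop,
        ‖x (k + K) - l‖ ≤ c₁ * (k : ℝ) ^ ((1 - θ) / (1 - 2 * θ)))) :
    ∃ ϱ c₁ : ℝ, 0 < ϱ ∧ ϱ < 1 ∧ 0 < c₁ ∧
      (θ = 1 / 2 → ∀ᶠ k : ℕ in atTop, ‖x k - l‖ ≤ c₁ * ϱ ^ k) ∧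
      (1 / 2 < θ → ∀ᶠ k : ℕ in atTop, ‖x k - l‖ ≤ c₁ * (k : ℝ) ^ ((1 - θ) / (1 - 2 * θ))) := by
  obtain ⟨ϱ, c, h0, h1, hc, hlin, hsub⟩ := h
  rcases eq_or_lt_of_le hθ with hθe | hθl
  · refine ⟨ϱ, c / ϱ ^ K, h0, h1, by positivity, fun _ => ?_, fun h => absurd hθe h.ne⟩
    rw [← map_add_atTop_eq_nat K, eventually_map]
    filter_upwards [hlin hθe.symm] with k hk
    rw [pow_add]
    refine hk.trans_eq (by field_simp)
  · set e := (1 - θ) / (1 - 2 * θ) with he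
    have he0 : e ≤ 0 := div_nonpos_of_nonneg_of_nonpos (by linarith) (by linarith)
    refine ⟨ϱ, c * (1 / 2) ^ e, h0, h1, by positivity, fun h => absurd h hθl.ne', fun _ => ?_⟩
    rw [← map_add_atTop_eq_nat K, eventually_map]
    filter_upwards [hsub hθl, eventually_ge_atTop (K + 1)] with k hk hkK
    have hkK' : (K : ℝ) + 1 ≤ k := by exact_mod_cast hkK
    have hK0 : (0 : ℝ) ≤ K := Nat.cast_nonneg K
    refine hk.trans ?_
    rw [mul_assoc, ← Real.mul_rpow (by norm_num) (by positivity)]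
    have h2 : (k : ℝ) ^ e ≤ (1 / 2 * ((k + K : ℕ) : ℝ)) ^ e :=
      Real.rpow_le_rpow_of_nonpos (by push_cast; linarith) (by push_cast; linarith) he0
    gcongr

end VMiPG

/-! ### Assembly of the convergence theorem -/

theorem mainTheorem4 {X : Type*} [NormedAddCommGroup X] [InnerProductSpace ℝ X]
    [FiniteDimensional ℝ X] (f g : X → EReal) (O : Set X) (hfg : VMiPG.BasicAssumption f g O)
    (μ β σ : ℝ) (ε : ℕ → ℝ) (G : ℕ → X →L[ℝ] X) (x y : ℕ → X) (m : ℕ → ℕ)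
    (hseq : VMiPG.IsVMiPGSequence f g μ β σ ε G x y m)
    (hbdd : Bornology.IsBounded (Set.range x))
    (μbar : ℝ) (hμbar : 0 < μbar) (hG : ∀ k, ‖G k‖ ≤ μbar)
    (r : ℝ) (hr : 0 < r)
    (hball : (⋃ s ∈ VMiPG.stationarySet f g, Metric.closedBall s r) ⊆ O)
    (hlip : (⨆ z ∈ ⋃ s ∈ VMiPG.stationarySet f g, Metric.closedBall s r,
      VMiPG.lipModulus (VMiPG.grad f) z) < ENNReal.ofReal μbar)
    (θ : ℝ) (hθ : 1 / 2 ≤ θ) (hθ' : θ < 1)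
    (hKL : VMiPG.IsKLFunctionOfExponent (VMiPG.objective f g) θ) :
    ∃ xbar ∈ VMiPG.stationarySet f g, Filter.Tendsto x Filter.atTop (nhds xbar) ∧
      ∃ ϱ c₁ : ℝ, 0 < ϱ ∧ ϱ < 1 ∧ 0 < c₁ ∧
        (θ = 1 / 2 → ∀ᶠ k : ℕ in Filter.atTop, ‖x k - xbar‖ ≤ c₁ * ϱ ^ k) ∧
        (1 / 2 < θ → ∀ᶠ k : ℕ in Filter.atTop,
          ‖x k - xbar‖ ≤ c₁ * (k : ℝ) ^ ((1 - θ) / (1 - 2 * θ))) := by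
  open VMiPG in
  have hμ := hseq.μ_pos
  have hθ0 : 0 < θ := by linarith
  obtain ⟨R, hR⟩ := hbdd.exists_norm_le
  have hR' : ∀ k, ‖x k‖ ≤ R := fun k => hR _ ⟨k, rfl⟩
  obtain ⟨D, hD⟩ := hseq.exists_norm_sub_le hfg hbdd
  have hD0 : 0 ≤ D := (norm_nonneg _).trans (hD 0)
  -- a compact convex set containing the relevant iterates
  set K : Set X := Metric.closedBall 0 (R + 2 * D) ∩ closure (dom g) with hKdef
  have hKc : IsCompact K := (isCompact_closedBall _ _).inter_right isClosed_closure
  have hKconv : Convex ℝ K :=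
    (convex_closedBall _ _).inter (hfg.convex_g.convexOn_realPart hfg.proper_g).1.closure
  have hKO : K ⊆ O := Set.inter_subset_right.trans hfg.closure_dom_subset
  obtain ⟨L, hL0, hL⟩ := hfg.exists_lipschitz_grad hKc hKO
  have hmemK : ∀ k, ∀ u ∈ dom g, ‖u - x k‖ ≤ 2 * ‖y k - x k‖ → u ∈ K := fun k u hu hux => by
    refine ⟨?_, subset_closure hu⟩
    rw [mem_closedBall_zero_iff]
    calc ‖u‖ = ‖x k + (u - x k)‖ := by rw [add_sub_cancel]
      _ ≤ ‖x k‖ + ‖u - x k‖ := norm_add_le _ _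
      _ ≤ R + 2 * D := by linarith [hR' k, hD k]
  have hxK : ∀ k, x k ∈ K := fun k =>
    hmemK k _ (hseq.x_mem_dom hfg k) (by rw [sub_self, norm_zero]; positivity)
  have hyK : ∀ k, y k ∈ K := fun k =>
    hmemK k _ (hseq.y_mem_dom hfg k) (by linarith [norm_nonneg (y k - x k)])
  -- sufficient decrease
  set A := σ * min 1 (β * ((μ / 2 - σ) / L)) with hAdef
  have hA : 0 < A := by
    have h1 := hseq.σ_lt_half
    have h2 : 0 < μ / 2 - σ := by linarith
    have := hseq.β_pos
    exact mul_pos hseq.σ_pos (lt_min one_pos (by positivity))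
  have hdec : ∀ k, A * ‖y k - x k‖ ^ 2 ≤
      realObjective f g (x k) - realObjective f g (x (k + 1)) := fun k => by
    refine le_trans ?_ (hseq.decrease hfg k)
    rw [hAdef]
    have := hseq.σ_pos
    gcongr
    exact hseq.step_size_ge hfg hKconv hKO hL0 hL (hxK k) (hyK k)
  have hd0 := hseq.tendsto_norm_sub_zero hfg hA hdec
  -- exact minimizers of the models
  choose w hw hsub hyw hmod using hseq.exists_minimizer hfg
  obtain ⟨N, hN⟩ := hseq.ε_eventually_le
  have hwx : ∀ k ≥ N, ‖w k - x k‖ ≤ 2 * ‖y k - x k‖ := fun k hk => by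
    have h1 : ‖y k - w k‖ ≤ ‖y k - x k‖ := by
      refine (sq_le_sq₀ (norm_nonneg _) (norm_nonneg _)).1 ?_
      have h2 : ε k * ‖y k - x k‖ ^ 2 ≤ μ / 2 * ‖y k - x k‖ ^ 2 := by
        gcongr; linarith [hN k hk]
      exact le_of_mul_le_mul_left ((hyw k).trans h2) (by positivity)
    calc ‖w k - x k‖ = ‖(y k - x k) - (y k - w k)‖ := by rw [sub_sub_sub_cancel_left]
      _ ≤ ‖y k - x k‖ + ‖y k - w k‖ := norm_sub_le _ _
      _ ≤ _ := by linarith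
  have hwx0 : Tendsto (fun k => w k - x k) atTop (𝓝 0) := by
    rw [tendsto_zero_iff_norm_tendsto_zero]
    have h1 : Tendsto (fun k => 2 * ‖y k - x k‖) atTop (𝓝 0) := by
      simpa using hd0.const_mul 2
    exact squeeze_zero' (Eventually.of_forall fun _ => norm_nonneg _)
      (eventually_atTop.2 ⟨N, hwx⟩) h1
  -- the next objective value compared with that at the minimizer
  set C₁ := 5 * L + 2 * μbar + μ / 10 with hC₁
  have hnext : ∀ k ≥ N, realObjective f g (x (k + 1)) ≤
      realObjective f g (w k) + C₁ * ‖y k - x k‖ ^ 2 := fun k hk => by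
    refine (hseq.next_cases hfg k).1.trans ?_
    have hwK := hmemK k _ (hw k) (hwx k hk)
    have h1 := (abs_le.1 (hfg.abs_sub_sub_inner_le hKconv hKO hL0.le hL (hxK k) (hyK k))).2
    have h2 := (abs_le.1 (hfg.abs_sub_sub_inner_le hKconv hKO hL0.le hL (hxK k) hwK)).1
    have h3 := hmod k
    have h4 : inner ℝ (w k - x k) (G k (w k - x k)) ≤ μbar * ‖w k - x k‖ ^ 2 := by
      calc inner ℝ (w k - x k) (G k (w k - x k)) ≤ ‖w k - x k‖ * ‖G k (w k - x k)‖ :=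
            real_inner_le_norm _ _
        _ ≤ ‖w k - x k‖ * (μbar * ‖w k - x k‖) := by
            gcongr; exact (G k).le_of_opNorm_le (hG k) _
        _ = _ := by ring
    have h5 : ‖w k - x k‖ ^ 2 ≤ 4 * ‖y k - x k‖ ^ 2 := by
      calc ‖w k - x k‖ ^ 2 ≤ (2 * ‖y k - x k‖) ^ 2 := by gcongr; exact hwx k hk
        _ = _ := by ring
    have h6 : ε k * ‖y k - x k‖ ^ 2 ≤ μ / 10 * ‖y k - x k‖ ^ 2 := by gcongr; exact hN k hk
    have h7 := mul_le_mul_of_nonneg_left h5 hL0.le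
    have h8 := mul_le_mul_of_nonneg_left h5 hμbar.le
    have h9 : 0 ≤ μ / 2 * ‖y k - x k‖ ^ 2 := by positivity
    simp only [realObjective, hC₁]
    linarith
  -- the Kurdyka-Łojasiewicz inequality at the minimizers
  obtain ⟨C, hC, hCk⟩ := hseq.exists_eventually_rpow_le hfg hbdd hG hθ' hKL hw hsub hwx0
  set C₂ := C * (2 * (L + μbar)) with hC₂
  have hC₂0 : 0 < C₂ := by positivity
  have hC₁0 : 0 < C₁ := by positivity
  have hrec : ∀ᶠ k in atTop, (realObjective f g (x (k + 1)) - limitValue f g x) ^ θ ≤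
      (C₂ + C₁ ^ θ) * ‖y k - x k‖ := by
    filter_upwards [hCk, eventually_ge_atTop N, hd0.eventually (eventually_le_nhds one_pos)]
      with k hk hkN hd1
    have hgap := (hseq.antitone_objective hfg).le_of_tendsto (hseq.tendsto_limitValue hfg) (k + 1)
    -- `F (w k)` may lie below the limit value, where KL gives nothing; the positive part covers
    -- both cases.
    set s := max (realObjective f g (w k) - limitValue f g x) 0 with hsdef
    have hs1 : s ^ θ ≤ C₂ * ‖y k - x k‖ := by
      rcases le_or_gt (realObjective f g (w k)) (limitValue f g x) with hle | hlt
      · rw [hsdef, max_eq_right (by linarith), Real.zero_rpow hθ0.ne']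
        positivity
      · rw [hsdef, max_eq_left (by linarith)]
        refine (hk hlt).trans ?_
        have hwK := hmemK k _ (hw k) (hwx k hkN)
        have h1 : ‖grad f (w k) + (-grad f (x k) - G k (w k - x k))‖ ≤
            (L + μbar) * ‖w k - x k‖ := by
          calc _ = ‖(grad f (w k) - grad f (x k)) - G k (w k - x k)‖ := by congr 1; abel
            _ ≤ ‖grad f (w k) - grad f (x k)‖ + ‖G k (w k - x k)‖ := norm_sub_le _ _
            _ ≤ L * ‖w k - x k‖ + μbar * ‖w k - x k‖ :=
              add_le_add (hL _ hwK _ (hxK k)) ((G k).le_of_opNorm_le (hG k) _)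
            _ = _ := by ring
        calc _ ≤ C * ((L + μbar) * ‖w k - x k‖) := by gcongr
          _ ≤ C * ((L + μbar) * (2 * ‖y k - x k‖)) := by gcongr; exact hwx k hkN
          _ = _ := by rw [hC₂]; ring
    have h2 : realObjective f g (x (k + 1)) - limitValue f g x ≤ s + C₁ * ‖y k - x k‖ ^ 2 := by
      have := le_max_left (realObjective f g (w k) - limitValue f g x) 0
      linarith [hnext k hkN]
    have h3 : (‖y k - x k‖ ^ 2) ^ θ ≤ ‖y k - x k‖ := by
      have hpos := hseq.norm_sub_pos hfg k
      rw [← Real.rpow_natCast_mul hpos.le]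
      calc ‖y k - x k‖ ^ (((2 : ℕ) : ℝ) * θ) ≤ ‖y k - x k‖ ^ (1 : ℝ) :=
            Real.rpow_le_rpow_of_exponent_ge hpos hd1 (by push_cast; linarith)
        _ = _ := Real.rpow_one _
    -- Subadditivity of `t ↦ t ^ θ` separates the error, and `‖d‖ ^ (2 * θ) ≤ ‖d‖` because `‖d‖ ≤ 1`
    -- and `2 * θ ≥ 1`.
    calc _ ≤ (s + C₁ * ‖y k - x k‖ ^ 2) ^ θ := Real.rpow_le_rpow (by linarith) h2 hθ0.le
      _ ≤ s ^ θ + (C₁ * ‖y k - x k‖ ^ 2) ^ θ :=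
        Real.rpow_add_le_add_rpow (le_max_right _ _) (by positivity) hθ0.le hθ'.le
      _ = s ^ θ + C₁ ^ θ * (‖y k - x k‖ ^ 2) ^ θ := by
        rw [Real.mul_rpow hC₁0.le (by positivity)]
      _ ≤ C₂ * ‖y k - x k‖ + C₁ ^ θ * ‖y k - x k‖ := by gcongr
      _ = _ := by ring
  obtain ⟨J, hJ⟩ := eventually_atTop.1 hrec
  -- a cluster point
  obtain ⟨xbar, -, hcl⟩ := hKc.exists_mapClusterPt (f := atTop) (u := x)
    (by rw [le_principal_iff]; exact mem_map.2 (Eventually.of_forall hxK))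
  obtain ⟨l, hl, hxl⟩ := mapClusterPt_iff_ultrafilter.1 hcl
  obtain ⟨hxd, -, hxs⟩ := hseq.mem_stationarySet_of_tendsto hfg hG hw hsub hwx0 hl hxl
  have hcl' : MapClusterPt xbar atTop (fun k => x (k + J)) := by
    have : map (fun k => x (k + J)) atTop = map x atTop := by
      rw [show (fun k => x (k + J)) = x ∘ (fun k => k + J) from rfl, ← Filter.map_map,
        map_add_atTop_eq_nat]
    unfold MapClusterPt
    rw [this]; exact hcl
  have hshift : ∀ k, k + 1 + J = k + J + 1 := fun k => by omega
  -- Directions never vanish, so each decrease is strict and the limit value is not attained by any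
  -- iterate; the powers of the gap are therefore positive.
  have hpos : ∀ k, 0 < realObjective f g (x k) - limitValue f g x := fun k => by
    have h1 := (hseq.antitone_objective hfg).le_of_tendsto (hseq.tendsto_limitValue hfg) (k + 1)
    have h2 := hdec k
    have h3 : 0 < A * ‖y k - x k‖ ^ 2 := mul_pos hA (pow_pos (hseq.norm_sub_pos hfg k) 2)
    linarith
  have hgap0 : Tendsto (fun k => realObjective f g (x k) - limitValue f g x) atTop (𝓝 0) := by
    simpa using (hseq.tendsto_limitValue hfg).sub_const (limitValue f g x)
  obtain ⟨hlim, hrates⟩ := rates_of_recursion (x := fun k => x (k + J))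
    (s := fun k => ‖y (k + J) - x (k + J)‖)
    (Δ := fun k => realObjective f g (x (k + J)) - limitValue f g x)
    hθ hθ' hA (by positivity : 0 < C₂ + C₁ ^ θ) (fun _ => norm_nonneg _) (fun k => hpos _)
    ((tendsto_add_atTop_iff_nat (f := fun k => realObjective f g (x k) - limitValue f g x) J).2
      hgap0)
    ((tendsto_add_atTop_iff_nat (f := fun k => ‖y k - x k‖) J).2 hd0)
    (fun k => by rw [hshift]; exact (hseq.next_cases hfg (k + J)).2.2)
    (fun k => by rw [hshift, sub_sub_sub_cancel_right]; exact hdec (k + J))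
    (fun k => by rw [hshift]; exact hJ (k + J) (by omega)) hcl'
  exact ⟨xbar, regularSubdiff_subset_subdiff _ _
    (mem_regularSubdiff_of_subgradient hfg.proper_g hxd hxs),
    (tendsto_add_atTop_iff_nat J).1 hlim, rates_of_shift hθ hθ' J hrates⟩
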